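/- Let $d\ge 2$, $k>0$, $R>0$, let $B_R\subset\mathbb{R}^d$ be the open ball of radius $R$ centered at the origin, and let $f\in L^2(B_R)$ be complex-valued. Let $n:\mathbb{R}^d\to\mathbb{R}$ satisfy $$n\in L^\infty(\mathbb{R}^d),\qquad n(x)\ge n_*>0\ \text{ for every } x\in\mathbb{R}^d,$$ for some constant $n_*$, and $$\Big\|1-\frac{n_\sharp(|x|)}{n(x)}\Big\|_{L^\infty(\mathbb{R}^d)}<1,\qquad\text{where } n_\sharp(r)=\frac1{|\partial B_r|}\int_{\partial B_r} n\,d\sigma .$$ Let $\mathcal{D}_R$ be the set of complex-valued $u\in H^1(B_R)$ that solve $\Delta u+k^2n(x)^2u=f$ in $B_R$ weakly, that is, $$-\int_{B_R}\nabla u\cdot\nabla\overline{\varphi}\,dx+k^2\int_{B_R}n(x)^2u\,\overline{\varphi}\,dx=\int_{B_R}f\,\overline{\varphi}\,dx\qquad\text{for all }\varphi\in C^1_0(B_R)$$ (complex-valued $C^1$ functions with compact support in $B_R$). For $u\in H^1(B_R)$ put $$[u]_R=\Big(\int_{B_R}\Big|\nabla u-ik\,n(x)\,u\,\frac{x}{|x|}\Big|^2\frac{dx}{1+|x|}\Big)^{1/2},\qquad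 d_R=\inf\{[u]_R:\ u\in\mathcal{D}_R\}.$$ Then there exists a unique $u_{B_R}\in\mathcal{D}_R$ such that $[u_{B_R}]_R=d_R$. -/

import Mathlib

open MeasureTheory Metric

noncomputable section

namespace Helmholtz

/-- The space `ℝ^d` with its Euclidean norm. -/
abbrev Space (d : ℕ) : Type := EuclideanSpace ℝ (Fin d)

/-- Complex vectors `ℂ^d` with the Hermitian norm (values of gradients of complex functions). -/
abbrev CVec (d : ℕ) : Type := EuclideanSpace ℂ (Fin d)

/-- Classical partial derivative `∂φ/∂x_i` of a complex-valued function on `ℝ^d`. -/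
def partialDeriv {d : ℕ} (i : Fin d) (φ : Space d → ℂ) (x : Space d) : ℂ :=
  fderiv ℝ φ x (EuclideanSpace.single i (1 : ℝ))

/-- `φ` belongs to `C_c^m(Ω)`: of class `C^m`, with compact support contained in `Ω`. -/
structure IsTestFunction {d : ℕ} (m : ℕ∞) (Ω : Set (Space d)) (φ : Space d → ℂ) : Prop where
  contDiff : ContDiff ℝ (m : WithTop ℕ∞) φ
  hasCompactSupport : HasCompactSupport φ
  tsupport_subset : tsupport φ ⊆ Ω

/-- `L²(Ω)`, complex-valued. -/
abbrev L2 {d : ℕ} (Ω : Set (Space d)) : Type := Lp ℂ 2 (volume.restrict Ω)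

/-- `L²(Ω; ℂ^d)`. -/
abbrev L2Vec {d : ℕ} (Ω : Set (Space d)) : Type := Lp (CVec d) 2 (volume.restrict Ω)

/-- `G` is the weak (distributional) gradient of `u` in `Ω`. -/
def IsWeakGradient {d : ℕ} (Ω : Set (Space d)) (u : L2 Ω) (G : L2Vec Ω) : Prop :=
  ∀ φ : Space d → ℂ, IsTestFunction ⊤ Ω φ → ∀ i : Fin d,
    ∫ x in Ω, u x * partialDeriv i φ x = -∫ x in Ω, G x i * φ x

/-- The Sobolev space `H¹(Ω)`: the (classes of) functions in `L²(Ω)` that have a weak gradient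
in `L²(Ω; ℂ^d)`. -/
def H1 {d : ℕ} (Ω : Set (Space d)) : Set (L2 Ω) :=
  {u | ∃ G : L2Vec Ω, IsWeakGradient Ω u G}

/-- The weak gradient `∇u` of `u ∈ H¹(Ω)`. -/
def weakGradient {d : ℕ} {Ω : Set (Space d)} (u : H1 Ω) : L2Vec Ω :=
  Classical.choose u.property

theorem weakGradient_spec {d : ℕ} {Ω : Set (Space d)} (u : H1 Ω) :
    IsWeakGradient Ω u (weakGradient u) :=
  Classical.choose_spec u.property

/-- The ball `B_R` of radius `R` centred at the origin of `ℝ^d`. -/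
abbrev B (d : ℕ) (R : ℝ) : Set (Space d) := ball (0 : Space d) R

/-- `u ∈ H¹(B_R)` is a weak solution of `Δu + k² n² u = f` in `B_R`. -/
def IsWeakSolution {d : ℕ} (k : ℝ) (n : Space d → ℝ) (f : Space d → ℂ) (R : ℝ)
    (u : H1 (B d R)) : Prop :=
  ∀ φ : Space d → ℂ, IsTestFunction 1 (B d R) φ →
    -(∫ x in B d R, ∑ i, weakGradient u x i * starRingEnd ℂ (partialDeriv i φ x))
      + (k : ℂ) ^ 2 * ∫ x in B d R, (n x : ℂ) ^ 2 * u.val x * starRingEnd ℂ (φ x)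
      = ∫ x in B d R, f x * starRingEnd ℂ (φ x)

/-- The set `𝓓_R` of weak solutions in `H¹(B_R)`. -/
def solutionSet {d : ℕ} (k : ℝ) (n : Space d → ℝ) (f : Space d → ℂ) (R : ℝ) :
    Set (H1 (B d R)) :=
  {u | IsWeakSolution k n f R u}

/-- The radial unit vector `x / |x|`, as a complex vector. -/
def radialUnit {d : ℕ} (x : Space d) : CVec d :=
  WithLp.toLp 2 fun i => ((x i / ‖x‖ : ℝ) : ℂ)

/-- `[u]_R = (∫_{B_R} |∇u - i k n u x/|x||² dx / (1 + |x|))^{1/2}`. -/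
def radiationSeminorm {d : ℕ} (k : ℝ) (n : Space d → ℝ) (R : ℝ) (u : H1 (B d R)) : ℝ :=
  Real.sqrt (∫ x in B d R,
    ‖weakGradient u x - (Complex.I * k * n x * u.val x) • radialUnit x‖ ^ 2 / (1 + ‖x‖))

/-- `d_R`, the infimum of `[u]_R` over `u ∈ 𝓓_R`. -/
def minValue {d : ℕ} (k : ℝ) (n : Space d → ℝ) (f : Space d → ℂ) (R : ℝ) : ℝ :=
  sInf (radiationSeminorm k n R '' solutionSet k n f R)

/-- `n_♯(r)`, the mean of `n` over the sphere `∂B_r` with respect to surface measure. The sphere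
is parametrised by `θ ↦ r θ` from the unit sphere, whose surface measure is `volume.toSphere`;
the Jacobian `r ^ (d - 1)` cancels in the mean. -/
def sphereMean {d : ℕ} (n : Space d → ℝ) (r : ℝ) : ℝ :=
  ⨍ θ : sphere (0 : Space d) 1, n (r • (θ : Space d)) ∂(volume : Measure (Space d)).toSphere

end Helmholtz

end

/-! The map `T (u, G) = (1 + |x|)^{-1/2} (G - i k n u x/|x|)` is bounded and linear on pairs in
`L²(B_R) × L²(B_R; ℂ^d)`, and `[u]_R = ‖T (u, ∇u)‖`. The solution pairs form a translate of the
closed space `W` of homogeneous solution pairs. If `T` is bounded below on `W`, then `T W` is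
complete and the orthogonal projection onto it yields one and only one minimiser
(`exists_minimizer_of_coercive`). What remains is that a solution exists and that `T` is bounded
below on `W`.

Existence (`exists_isWeakPair`). No boundary condition is imposed, so duality suffices. A Carleman
estimate with linear weight `exp (τ x_i)` gives `‖φ‖ ≤ C ‖Δφ + Vφ‖` for test functions; Hahn-Banach
and Riesz turn it into an `L²` distributional solution on a larger ball. Interior regularity,
obtained from energy bounds for `(1 - Δ)^{-1} ∂_i`, supplies the weak gradient on `B_R`.

Lower bound (`mul_norm_le_of_radiation`). Since `n` is real, a homogeneous solution has no net flux
through any sphere centred at `0`. Integrated over radii, this reads `Im ∫ (x/|x| · conj ∇u) u = 0`.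
Writing `∇u = (∇u - i k n u x/|x|) + i k n u x/|x|` gives `k ∫ n |u|² ≤ ‖∇u - i k n u x/|x|‖ ‖u‖`.
As `n ≥ n_* > 0`, the seminorm controls `‖u‖`, and then `‖∇u‖`.

The flux identity requires testing the equation with `η u`, where `η` is a smooth cutoff. This, and
the passage from smooth to `C¹` test functions, rests on the density of Schwartz functions in
`H¹(ℝ^d)` (`IsWeakJet.mem_closure`). -/

noncomputable section

namespace Helmholtz

open scoped SchwartzMap LineDeriv Laplacian ComplexConjugate

/-! ### Bilinear pairing on `L²` and representation of functionals. -/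

section L2

variable {X : Type*} [MeasurableSpace X] {μ : Measure X}

/-- The bilinear pairing `z ↦ ∫ a z` on `L²`, as a continuous linear functional of `z`. -/
def pairing (a : Lp ℂ 2 μ) : Lp ℂ 2 μ →L[ℂ] ℂ := innerSL ℂ (star a)

theorem pairing_apply (a z : Lp ℂ 2 μ) : pairing a z = ∫ x, a x * z x ∂μ := by
  rw [pairing, innerSL_apply_apply, L2.inner_def]
  refine integral_congr_ae ?_
  filter_upwards [Lp.coeFn_star a] with x hx
  simp [hx, mul_comm]

theorem pairing_comm (a z : Lp ℂ 2 μ) : pairing a z = pairing z a := by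
  simp only [pairing_apply, mul_comm]

theorem norm_integral_mul_le {a b : X → ℂ} (ha : MemLp a 2 μ) (hb : MemLp b 2 μ) :
    ‖∫ x, a x * b x ∂μ‖ ≤ (eLpNorm a 2 μ).toReal * (eLpNorm b 2 μ).toReal := by
  have h : ∫ x, a x * b x ∂μ = pairing (ha.toLp a) (hb.toLp b) := by
    rw [pairing_apply]
    refine integral_congr_ae ?_
    filter_upwards [ha.coeFn_toLp, hb.coeFn_toLp] with x h1 h2
    rw [h1, h2]
  rw [h, pairing]
  refine (norm_inner_le_norm (𝕜 := ℂ) (star (ha.toLp a)) (hb.toLp b)).trans ?_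
  have hstar : ‖star (ha.toLp a)‖ = ‖ha.toLp a‖ := by
    rw [Lp.norm_def, Lp.norm_def]
    congr 1
    refine eLpNorm_congr_norm_ae ?_
    filter_upwards [Lp.coeFn_star (ha.toLp a)] with x hx
    simp [hx]
  rw [hstar, Lp.norm_toLp, Lp.norm_toLp]

/-- The bound makes `l` vanish on `ker A`, so `l` descends to a bounded functional on the range of
`A`; Hahn-Banach extends it and Riesz represents it. This is how a priori estimates become existence
statements. -/
theorem exists_integral_mul_eq {V : Type*} [AddCommGroup V] [Module ℂ V]
    (A : V →ₗ[ℂ] Lp ℂ 2 μ) (l : V →ₗ[ℂ] ℂ) (C : ℝ) (h : ∀ x, ‖l x‖ ≤ C * ‖A x‖) :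
    ∃ w : Lp ℂ 2 μ, ∀ x, l x = ∫ y, w y * A x y ∂μ := by
  have hker : LinearMap.ker A ≤ LinearMap.ker l := by
    intro x hx
    rw [LinearMap.mem_ker] at hx ⊢
    simpa [hx] using h x
  let e := A.quotKerEquivRange
  let l' : LinearMap.range A →ₗ[ℂ] ℂ := (LinearMap.ker A).liftQ l hker ∘ₗ e.symm.toLinearMap
  have hl' : ∀ x, l' ⟨A x, LinearMap.mem_range_self A x⟩ = l x := by
    intro x
    have : e.symm ⟨A x, LinearMap.mem_range_self A x⟩ = (LinearMap.ker A).mkQ x :=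
      A.quotKerEquivRange_symm_apply_image x _
    simp [l', this]
  let m : StrongDual ℂ (LinearMap.range A) := l'.mkContinuous C (by
    rintro ⟨_, x, rfl⟩
    rw [hl']
    exact h x)
  obtain ⟨g, hg, -⟩ := exists_extension_norm_eq (LinearMap.range A) m
  -- Riesz represents through the Hermitian product; `star` converts it to the bilinear pairing.
  refine ⟨star ((InnerProductSpace.toDual ℂ _).symm g), fun x => ?_⟩
  rw [← pairing_apply, pairing, star_star, innerSL_apply_apply, InnerProductSpace.toDual_symm_apply,
    ← hl' x]
  exact (hg ⟨A x, LinearMap.mem_range_self A x⟩).symm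

end L2

/-! ### The resolvent of the Laplacian on Schwartz functions. -/

section Schwartz

variable {d : ℕ}

theorem hasTemperateGrowth_resolvent :
    (fun x : Space d => ((1 + (2 * Real.pi) ^ 2 * ‖x‖ ^ 2)⁻¹ : ℝ)).HasTemperateGrowth := by
  have h1 : (fun x : Space d => (1 + ‖x‖ ^ 2) ^ (-1 : ℝ) : Space d → ℝ).HasTemperateGrowth := by
    fun_prop
  have h2 : (fun x : Space d => (2 * Real.pi) • x).HasTemperateGrowth := by fun_prop
  convert h1.comp h2 using 2 with x
  simp [Real.rpow_neg_one, norm_smul, mul_pow]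

/-- `1 - Δ` is onto on Schwartz functions. -/
theorem exists_sub_laplacian_eq (f : 𝓢(Space d, ℂ)) : ∃ g : 𝓢(Space d, ℂ), g - Δ g = f := by
  let m : Space d → ℝ := fun x => ((1 + (2 * Real.pi) ^ 2 * ‖x‖ ^ 2)⁻¹ : ℝ)
  have hm : m.HasTemperateGrowth := hasTemperateGrowth_resolvent
  have hs : (fun x : Space d => ‖x‖ ^ 2).HasTemperateGrowth := by fun_prop
  refine ⟨SchwartzMap.fourierMultiplierCLM ℂ m f, ?_⟩
  rw [SchwartzMap.laplacian_eq_fourierMultiplierCLM,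
    SchwartzMap.fourierMultiplierCLM_fourierMultiplierCLM_apply hs hm, neg_smul, sub_neg_eq_add]
  simp only [SchwartzMap.fourierMultiplierCLM_apply]
  rw [← FourierTransform.fourierInv_smul, ← FourierTransform.fourierInv_add]
  conv_rhs => rw [← FourierTransform.fourierInv_fourier_eq (F := 𝓢(Space d, ℂ)) f]
  congr 1
  ext x
  rw [add_apply, smul_apply, SchwartzMap.smulLeftCLM_apply_apply hm,
    SchwartzMap.smulLeftCLM_apply_apply (hs.mul hm), smul_smul, ← add_smul]
  have : m x + (2 * Real.pi) ^ 2 * (‖x‖ ^ 2 * m x) = 1 := by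
    simp only [m]
    field_simp
  simp [this]

end Schwartz

/-! ### Density of Schwartz functions in `H¹(ℝ^d)`. -/

section Density

variable {d : ℕ}

/-- Complex conjugation on Schwartz functions. -/
def conjSchwartz (f : 𝓢(Space d, ℂ)) : 𝓢(Space d, ℂ) :=
  SchwartzMap.postcompCLM (Complex.conjCLE : ℂ →L[ℝ] ℂ) f

theorem conjSchwartz_apply (f : 𝓢(Space d, ℂ)) (x : Space d) : conjSchwartz f x = conj (f x) := by
  simp [conjSchwartz]

theorem lineDerivOp_conjSchwartz (f : 𝓢(Space d, ℂ)) (m x : Space d) :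
    ∂_{m} (conjSchwartz f) x = conj (∂_{m} f x) := by
  have h : (conjSchwartz f : Space d → ℂ) = (Complex.conjCLE : ℂ →L[ℝ] ℂ) ∘ f := by
    ext x; simp [conjSchwartz_apply]
  rw [SchwartzMap.lineDerivOp_apply_eq_fderiv, h,
    (((Complex.conjCLE : ℂ →L[ℝ] ℂ).hasFDerivAt).comp x (f.hasFDerivAt x)).fderiv]
  simp [SchwartzMap.lineDerivOp_apply_eq_fderiv]

/-- Pairs of an `L²` function and an `L²` vector field on `ℝ^d`. -/
abbrev JetSpace (d : ℕ) : Type :=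
  PiLp 2 (fun _ : Option (Fin d) => Lp ℂ 2 (volume : Measure (Space d)))

/-- The pair of the function `v` and the vector field `F`. -/
def mkJet (v : Lp ℂ 2 (volume : Measure (Space d)))
    (F : Fin d → Lp ℂ 2 (volume : Measure (Space d))) : JetSpace d :=
  WithLp.toLp 2 fun o => o.elim v F

theorem mkJet_none (v : Lp ℂ 2 (volume : Measure (Space d)))
    (F : Fin d → Lp ℂ 2 (volume : Measure (Space d))) : mkJet v F none = v := rfl

theorem mkJet_some (v : Lp ℂ 2 (volume : Measure (Space d)))
    (F : Fin d → Lp ℂ 2 (volume : Measure (Space d))) (i : Fin d) : mkJet v F (some i) = F i := rfl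

/-- A Schwartz function together with its partial derivatives. -/
def schwartzJet : 𝓢(Space d, ℂ) →ₗ[ℂ] JetSpace d where
  toFun f := mkJet (SchwartzMap.toLpCLM ℂ ℂ 2 volume f)
    fun i => SchwartzMap.toLpCLM ℂ ℂ 2 volume (∂_{EuclideanSpace.single i (1 : ℝ)} f)
  map_add' f g := by
    ext1 o
    cases o <;> simp only [mkJet_none, mkJet_some, PiLp.add_apply, LineDeriv.lineDerivOp_add, map_add]
  map_smul' c f := by
    ext1 o
    cases o <;> simp only [mkJet_none, mkJet_some, PiLp.smul_apply, LineDeriv.lineDerivOp_smul, map_smul,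
      RingHom.id_apply]

theorem schwartzJet_none (f : 𝓢(Space d, ℂ)) : schwartzJet f none = f.toLp 2 := rfl

theorem schwartzJet_some (f : 𝓢(Space d, ℂ)) (i : Fin d) :
    schwartzJet f (some i) = (∂_{EuclideanSpace.single i (1 : ℝ)} f).toLp 2 := rfl

/-- The last components of the pair are the weak partial derivatives of the first one. -/
def IsWeakJet (z : JetSpace d) : Prop :=
  ∀ (f : 𝓢(Space d, ℂ)) (i : Fin d),
    pairing ((∂_{EuclideanSpace.single i (1 : ℝ)} f).toLp 2) (z none)
      = -pairing (f.toLp 2) (z (some i))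

theorem pairing_toLp (f : 𝓢(Space d, ℂ)) (z : Lp ℂ 2 (volume : Measure (Space d))) :
    pairing (f.toLp 2) z = ∫ x, f x * z x := by
  rw [pairing_apply]
  refine integral_congr_ae ?_
  filter_upwards [f.coeFn_toLp 2] with x hx
  rw [hx]

theorem pairing_toLp_toLp (f g : 𝓢(Space d, ℂ)) :
    pairing (f.toLp 2 volume) (g.toLp 2 volume) = ∫ x, f x * g x := by
  rw [pairing_toLp]
  refine integral_congr_ae ?_
  filter_upwards [g.coeFn_toLp 2] with x hx
  rw [hx]

theorem isWeakJet_schwartzJet (g : 𝓢(Space d, ℂ)) : IsWeakJet (schwartzJet g) := by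
  intro f i
  rw [schwartzJet_none, schwartzJet_some, pairing_toLp_toLp, pairing_toLp_toLp, SchwartzMap.integral_mul_lineDerivOp_right_eq_neg_left,
    neg_neg]

theorem isClosed_setOf_isWeakJet : IsClosed {z : JetSpace d | IsWeakJet z} := by
  simp only [IsWeakJet, Set.ofPred_forall]
  refine isClosed_iInter fun f => isClosed_iInter fun i => isClosed_eq ?_ ?_
  · exact (pairing _).continuous.comp (PiLp.continuous_apply 2 _ _)
  · exact ((pairing _).continuous.comp (PiLp.continuous_apply 2 _ _)).neg

theorem Lp_eq_zero_of_pairing_schwartz (z : Lp ℂ 2 (volume : Measure (Space d)))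
    (h : ∀ f : 𝓢(Space d, ℂ), pairing (f.toLp 2) z = 0) : z = 0 := by
  rw [Lp.eq_zero_iff_ae_eq_zero]
  refine ae_eq_zero_of_integral_contDiff_smul_eq_zero
    ((Lp.memLp z).locallyIntegrable one_le_two) fun g hg hc => ?_
  have hc' : HasCompactSupport fun x => (g x : ℂ) := hc.comp_left (g := ((↑) : ℝ → ℂ)) rfl
  have := h (hc'.toSchwartzMap (Complex.ofRealCLM.contDiff.comp hg))
  rw [pairing_toLp] at this
  simp only [Complex.real_smul]
  exact this

/-- Moving the derivatives onto the Schwartz function turns orthogonality into `∫ (f - Δ f) q₀ = 0`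
for the function component `q₀` of `q`. Since `1 - Δ` is onto, `q₀ = 0`, and its weak derivatives
vanish with it. -/
theorem eq_zero_of_isWeakJet_of_orthogonal {q : JetSpace d} (hq : IsWeakJet q)
    (ho : ∀ f : 𝓢(Space d, ℂ), inner ℂ (schwartzJet f) q = 0) : q = 0 := by
  have key : ∀ f : 𝓢(Space d, ℂ), pairing ((f - Δ f).toLp 2) (q none) = 0 := by
    intro f
    -- Conjugating `f` turns the Hermitian product into the bilinear pairing.
    have h := ho (conjSchwartz f)
    rw [PiLp.inner_apply, Fintype.sum_option] at h
    have h0 : inner ℂ (schwartzJet (conjSchwartz f) none) (q none)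
        = pairing (f.toLp 2) (q none) := by
      rw [schwartzJet_none, pairing_toLp, L2.inner_def]
      refine integral_congr_ae ?_
      filter_upwards [(conjSchwartz f).coeFn_toLp 2] with x hx
      simp [hx, conjSchwartz_apply, mul_comm]
    have hi : ∀ i : Fin d, inner ℂ (schwartzJet (conjSchwartz f) (some i)) (q (some i))
        = -pairing ((∂_{EuclideanSpace.single i (1 : ℝ)}
            (∂_{EuclideanSpace.single i (1 : ℝ)} f)).toLp 2) (q none) := by
      intro i
      rw [hq, neg_neg, schwartzJet_some, pairing_toLp, L2.inner_def]
      refine integral_congr_ae ?_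
      filter_upwards [(∂_{EuclideanSpace.single i (1 : ℝ)} (conjSchwartz f)).coeFn_toLp 2] with x hx
      simp [hx, lineDerivOp_conjSchwartz, mul_comm]
    rw [h0, Finset.sum_congr rfl fun i _ => hi i] at h
    rw [pairing_comm] at h ⊢
    simp only [pairing_comm _ (q none)] at h
    rw [← SchwartzMap.toLpCLM_apply (𝕜 := ℂ),
      SchwartzMap.laplacian_eq_sum (EuclideanSpace.basisFun (Fin d) ℝ), map_sub, map_sum, map_sub,
      map_sum, ← h, Finset.sum_neg_distrib, sub_eq_add_neg]
    simp
  have h0 : q none = 0 := by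
    refine Lp_eq_zero_of_pairing_schwartz _ fun f => ?_
    obtain ⟨g, hg⟩ := exists_sub_laplacian_eq f
    rw [← hg]
    exact key g
  ext1 o
  cases o with
  | none => exact h0
  | some i =>
    refine Lp_eq_zero_of_pairing_schwartz _ fun f => ?_
    have := hq f i
    rw [h0, map_zero] at this
    exact neg_eq_zero.mp this.symm

/-- Being a weak jet is a closed linear condition satisfied by Schwartz jets. Hence the residual of
the projection onto their closure is a weak jet orthogonal to all of them, so it is zero. -/
theorem IsWeakJet.mem_closure {v : JetSpace d} (hv : IsWeakJet v) :
    v ∈ (LinearMap.range (schwartzJet (d := d))).topologicalClosure := by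
  set K := (LinearMap.range (schwartzJet (d := d))).topologicalClosure with hK
  have hKc : IsClosed (K : Set (JetSpace d)) := Submodule.isClosed_topologicalClosure _
  have : CompleteSpace K := hKc.completeSpace_coe
  have hKw : ∀ z ∈ K, IsWeakJet z := fun z hz => by
    refine closure_minimal (s := (LinearMap.range (schwartzJet (d := d)) : Set (JetSpace d)))
      ?_ isClosed_setOf_isWeakJet hz
    rintro _ ⟨f, rfl⟩
    exact isWeakJet_schwartzJet f
  have hsub : v - K.starProjection v = 0 := by
    refine eq_zero_of_isWeakJet_of_orthogonal (fun f i => ?_) fun f => ?_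
    · have h1 := hv f i
      have h2 := hKw _ (K.starProjection_apply_mem v) f i
      rw [PiLp.sub_apply, PiLp.sub_apply, map_sub, map_sub, h1, h2]
      ring
    · exact (K.sub_starProjection_mem_orthogonal v) _
        (Submodule.le_topologicalClosure _ (LinearMap.mem_range_self _ f))
  rw [sub_eq_zero.mp hsub]
  exact K.starProjection_apply_mem v

end Density

/-! ### Cutoffs, and weak equations tested with `H¹` functions. -/

section Cutoff

variable {d : ℕ}

theorem IsTestFunction.continuous {m : ℕ∞} {Ω : Set (Space d)} {φ : Space d → ℂ}
    (h : IsTestFunction m Ω φ) : Continuous φ := h.contDiff.continuous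

theorem IsTestFunction.of_top {m : ℕ∞} {Ω : Set (Space d)} {φ : Space d → ℂ}
    (h : IsTestFunction ⊤ Ω φ) : IsTestFunction m Ω φ :=
  ⟨h.contDiff.of_le (by exact_mod_cast le_top), h.hasCompactSupport, h.tsupport_subset⟩

theorem IsTestFunction.mono {m : ℕ∞} {Ω Ω' : Set (Space d)} {φ : Space d → ℂ}
    (h : IsTestFunction m Ω φ) (hΩ : Ω ⊆ Ω') : IsTestFunction m Ω' φ :=
  ⟨h.contDiff, h.hasCompactSupport, h.tsupport_subset.trans hΩ⟩

theorem IsTestFunction.mul_contDiff {m : ℕ∞} {Ω : Set (Space d)} {φ g : Space d → ℂ}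
    (h : IsTestFunction m Ω φ) (hg : ContDiff ℝ m g) : IsTestFunction m Ω fun x => φ x * g x :=
  ⟨h.contDiff.mul hg, h.hasCompactSupport.mul_right,
    (tsupport_mul_subset_left (f := φ) (g := g)).trans h.tsupport_subset⟩

theorem IsTestFunction.partialDeriv {Ω : Set (Space d)} {φ : Space d → ℂ}
    (h : IsTestFunction ⊤ Ω φ) (i : Fin d) : IsTestFunction ⊤ Ω (partialDeriv i φ) :=
  ⟨(h.contDiff.fderiv_right (m := ((⊤ : ℕ∞) : WithTop ℕ∞)) (by simp)).clm_apply contDiff_const,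
    h.hasCompactSupport.fderiv_apply ℝ _,
    (tsupport_fderiv_apply_subset ℝ _).trans h.tsupport_subset⟩

theorem IsTestFunction.conj {m : ℕ∞} {Ω : Set (Space d)} {φ : Space d → ℂ}
    (h : IsTestFunction m Ω φ) : IsTestFunction m Ω fun x => conj (φ x) :=
  ⟨Complex.conjCLE.contDiff.comp h.contDiff, h.hasCompactSupport.comp_left (map_zero _),
    (tsupport_comp_subset (map_zero (starRingEnd ℂ)) φ).trans h.tsupport_subset⟩

theorem partialDeriv_conj {φ : Space d → ℂ} {x : Space d} (h : DifferentiableAt ℝ φ x)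
    (i : Fin d) : partialDeriv i (fun x => conj (φ x)) x = conj (partialDeriv i φ x) := by
  have := (((Complex.conjCLE : ℂ →L[ℝ] ℂ).hasFDerivAt).comp x h.hasFDerivAt).fderiv
  have h2 : (fun x => conj (φ x)) = (Complex.conjCLE : ℂ →L[ℝ] ℂ) ∘ φ := by
    ext x; simp
  rw [Helmholtz.partialDeriv, h2, this]
  simp [Helmholtz.partialDeriv]

theorem partialDeriv_mul {f g : Space d → ℂ} {x : Space d} (hf : DifferentiableAt ℝ f x)
    (hg : DifferentiableAt ℝ g x) (i : Fin d) :
    partialDeriv i (fun x => f x * g x) x = partialDeriv i f x * g x + f x * partialDeriv i g x := by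
  simp only [partialDeriv]
  rw [fderiv_fun_mul hf hg]
  simp
  ring

theorem lineDerivOp_single_apply (f : 𝓢(Space d, ℂ)) (i : Fin d) (x : Space d) :
    ∂_{EuclideanSpace.single i (1 : ℝ)} f x = partialDeriv i f x := rfl

theorem exists_cutoff {r R : ℝ} (hr : 0 < r) (hrR : r < R) :
    ∃ χ : Space d → ℂ, IsTestFunction ⊤ (ball (0 : Space d) R) χ ∧ ∀ x ∈ ball (0 : Space d) r,
      χ x = 1 := by
  -- The outer radius lies strictly below `R`, so the closed support stays inside the open ball.
  let b : ContDiffBump (0 : Space d) := ⟨r, (r + R) / 2, hr, by linarith⟩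
  have hs : HasCompactSupport fun x => (b x : ℂ) := b.hasCompactSupport.comp_left (g := ((↑) : ℝ → ℂ)) rfl
  refine ⟨fun x => (b x : ℂ), ⟨Complex.ofRealCLM.contDiff.comp b.contDiff, hs, ?_⟩, ?_⟩
  · refine (tsupport_comp_subset (g := ((↑) : ℝ → ℂ)) rfl b).trans ?_
    rw [b.tsupport_eq]
    exact closedBall_subset_ball (by simp only [b]; linarith)
  · intro x hx
    beta_reduce
    rw [b.one_of_mem_closedBall (ball_subset_closedBall hx), Complex.ofReal_one]

theorem partialDeriv_eq_zero_of_eq_const {U : Set (Space d)} (hU : IsOpen U) {χ : Space d → ℂ}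
    {c : ℂ} (h : ∀ x ∈ U, χ x = c) {x : Space d} (hx : x ∈ U) (i : Fin d) :
    partialDeriv i χ x = 0 := by
  have : χ =ᶠ[nhds x] fun _ => c := by
    filter_upwards [hU.mem_nhds hx] with y hy using h y hy
  rw [partialDeriv, this.fderiv_eq]
  simp

theorem memLp_mul_of_hasCompactSupport {μ : Measure (Space d)} {g a : Space d → ℂ}
    (hg : Continuous g) (hc : HasCompactSupport g) (ha : MemLp a 2 μ) :
    MemLp (fun x => g x * a x) 2 μ := by
  obtain ⟨C, hC⟩ := hg.bounded_above_of_compact_support hc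
  refine ha.of_le_mul (c := C) (hg.aestronglyMeasurable.mul ha.1) (ae_of_all _ fun x => ?_)
  rw [norm_mul]
  exact mul_le_mul_of_nonneg_right (hC x) (norm_nonneg _)

theorem pairing_indicator {Ω : Set (Space d)} (hΩ : MeasurableSet Ω) {g p : Space d → ℂ}
    (hg : MemLp (Ω.indicator g) 2 volume) (hp : MemLp p 2 volume) :
    pairing (hg.toLp _) (hp.toLp p) = ∫ x in Ω, g x * p x := by
  rw [pairing_apply, ← integral_indicator hΩ]
  refine integral_congr_ae ?_
  filter_upwards [hg.coeFn_toLp, hp.coeFn_toLp] with x h1 h2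
  rw [h1, h2]
  simp only [Set.indicator]
  split_ifs <;> simp

/-- A weak equation tested with smooth functions holds for weakly differentiable functions
supported where a smooth cutoff equals `1`. -/
theorem integral_add_sum_eq_zero_of_test {Ω : Set (Space d)} (hΩ : MeasurableSet Ω)
    {a : Space d → ℂ} {b : Fin d → Space d → ℂ} (ha : MemLp a 2 (volume.restrict Ω))
    (hb : ∀ i, MemLp (b i) 2 (volume.restrict Ω))
    (h : ∀ φ : Space d → ℂ, IsTestFunction ⊤ Ω φ →
      (∫ x in Ω, a x * φ x) + ∑ i, ∫ x in Ω, b i x * partialDeriv i φ x = 0)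
    {v : Space d → ℂ} {F : Fin d → Space d → ℂ} (hv : MemLp v 2 volume)
    (hF : ∀ i, MemLp (F i) 2 volume)
    (hw : ∀ (f : 𝓢(Space d, ℂ)) (i : Fin d),
      ∫ x, v x * partialDeriv i f x = -∫ x, F i x * f x)
    {χ : Space d → ℂ} (hχ : IsTestFunction ⊤ Ω χ) (h1 : ∀ x, χ x * v x = v x)
    (h2 : ∀ i x, χ x * F i x = F i x) (h3 : ∀ i x, partialDeriv i χ x * v x = 0) :
    (∫ x in Ω, a x * v x) + ∑ i, ∫ x in Ω, b i x * F i x = 0 := by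
  have hA0 : MemLp (Ω.indicator fun x => χ x * a x) 2 volume :=
    (memLp_indicator_iff_restrict hΩ).2
      (memLp_mul_of_hasCompactSupport hχ.continuous hχ.hasCompactSupport ha)
  have hA : ∀ i, MemLp (Ω.indicator fun x => partialDeriv i χ x * b i x) 2 volume := fun i =>
    (memLp_indicator_iff_restrict hΩ).2 (memLp_mul_of_hasCompactSupport
      (hχ.partialDeriv i).continuous (hχ.partialDeriv i).hasCompactSupport (hb i))
  have hB : ∀ i, MemLp (Ω.indicator fun x => χ x * b i x) 2 volume := fun i =>
    (memLp_indicator_iff_restrict hΩ).2 (memLp_mul_of_hasCompactSupport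
      hχ.continuous hχ.hasCompactSupport (hb i))
  -- The equation tested with `χ f`, expanded by the product rule. It involves only `L²` pairings
  -- with the jet of `f`, hence is continuous; vanishing on Schwartz jets, it vanishes on every weak
  -- jet.
  let Λ : JetSpace d → ℂ := fun z => pairing (hA0.toLp _) (z none)
    + ∑ i, (pairing ((hA i).toLp _) (z none) + pairing ((hB i).toLp _) (z (some i)))
  have hΛ : Continuous Λ := by
    refine ((pairing _).continuous.comp (PiLp.continuous_apply 2 _ _)).add
      (continuous_finsetSum _ fun i _ => ?_)
    exact ((pairing _).continuous.comp (PiLp.continuous_apply 2 _ _)).add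
      ((pairing _).continuous.comp (PiLp.continuous_apply 2 _ _))
  let z : JetSpace d := mkJet (hv.toLp v) fun i => (hF i).toLp (F i)
  have hz : IsWeakJet z := by
    intro f i
    have e1 : pairing ((∂_{EuclideanSpace.single i (1 : ℝ)} f).toLp 2) (hv.toLp v)
        = ∫ x, v x * partialDeriv i f x := by
      rw [pairing_toLp]
      refine integral_congr_ae ?_
      filter_upwards [hv.coeFn_toLp] with x hx
      rw [hx, lineDerivOp_single_apply, mul_comm]
    have e2 : pairing (f.toLp 2) ((hF i).toLp (F i)) = ∫ x, F i x * f x := by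
      rw [pairing_toLp]
      refine integral_congr_ae ?_
      filter_upwards [(hF i).coeFn_toLp] with x hx
      rw [hx, mul_comm]
    rw [mkJet_none, mkJet_some, e1, e2, hw]
  have hΛ0 : ∀ y ∈ (LinearMap.range (schwartzJet (d := d))).topologicalClosure, Λ y = 0 := by
    intro y hy
    refine closure_minimal (s := (LinearMap.range (schwartzJet (d := d)) : Set (JetSpace d)))
      (t := {y | Λ y = 0}) ?_ (isClosed_eq hΛ continuous_const) hy
    rintro _ ⟨f, rfl⟩
    simp only [Set.mem_ofPred_eq, Λ, schwartzJet_none, schwartzJet_some, SchwartzMap.toLp]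
    have hf : IsTestFunction ⊤ Ω fun x => χ x * f x := hχ.mul_contDiff (f.smooth ⊤)
    rw [← h _ hf, pairing_indicator hΩ]
    congr 1
    · refine integral_congr_ae (ae_of_all _ fun x => ?_)
      ring
    · refine Finset.sum_congr rfl fun i _ => ?_
      rw [pairing_indicator hΩ, pairing_indicator hΩ, ← integral_add]
      · refine integral_congr_ae (ae_of_all _ fun x => ?_)
        simp only [lineDerivOp_single_apply]
        rw [partialDeriv_mul (hχ.contDiff.differentiable (by simp) x) f.differentiableAt]
        ring
      · exact ((memLp_indicator_iff_restrict hΩ).1 (hA i)).integrable_mul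
          ((f.memLp 2 volume).restrict Ω)
      · exact ((memLp_indicator_iff_restrict hΩ).1 (hB i)).integrable_mul
          (((∂_{EuclideanSpace.single i (1 : ℝ)} f).memLp 2 volume).restrict Ω)
  -- At the jet `(v, F)` the cutoff disappears: `χ` acts as `1` and `∂χ` as `0`.
  have key : pairing (hA0.toLp _) (hv.toLp v)
    + ∑ i, (pairing ((hA i).toLp _) (hv.toLp v) + pairing ((hB i).toLp _) ((hF i).toLp (F i))) = 0 :=
    by simpa only [Λ, z, mkJet_none, mkJet_some] using hΛ0 z hz.mem_closure
  rw [← key, pairing_indicator hΩ]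
  congr 1
  · refine integral_congr_ae (ae_of_all _ fun x => ?_)
    change a x * v x = χ x * a x * v x
    rw [mul_right_comm, h1, mul_comm]
  · refine Finset.sum_congr rfl fun i _ => ?_
    rw [pairing_indicator hΩ, pairing_indicator hΩ]
    have : ∫ x in Ω, partialDeriv i χ x * b i x * v x = 0 := by
      simp only [mul_right_comm _ (b i _), h3, zero_mul, integral_zero]
    rw [this, zero_add]
    refine integral_congr_ae (ae_of_all _ fun x => ?_)
    change b i x * F i x = χ x * b i x * F i x
    rw [mul_right_comm, h2, mul_comm]

end Cutoff

/-! ### Admissible test functions on the ball: `C¹` functions and localised solutions. -/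

section Extension

variable {d : ℕ}

theorem memLp_coord {μ : Measure (Space d)} (G : Lp (CVec d) 2 μ) (i : Fin d) :
    MemLp (fun x => G x i) 2 μ :=
  (EuclideanSpace.proj i : CVec d →L[ℂ] ℂ).comp_memLp' (Lp.memLp G)

/-- A closed subset of the open ball lies in a smaller open ball; the cutoff equals `1` there, so
its gradient vanishes too. -/
theorem exists_cutoff_of_isClosed {R : ℝ} (hR : 0 < R) {K : Set (Space d)} (hK : IsClosed K)
    (h : K ⊆ B d R) : ∃ χ : Space d → ℂ, IsTestFunction ⊤ (B d R) χ ∧ (∀ x ∈ K, χ x = 1) ∧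
      ∀ i, ∀ x ∈ K, partialDeriv i χ x = 0 := by
  obtain ⟨r, hr, hKr⟩ := exists_pos_lt_subset_ball hR hK h
  obtain ⟨χ, hχ, h1⟩ := exists_cutoff (d := d) hr.1 hr.2
  exact ⟨χ, hχ, fun x hx => h1 x (hKr hx),
    fun i x hx => partialDeriv_eq_zero_of_eq_const isOpen_ball h1 (hKr hx) i⟩

theorem notMem_tsupport_partialDeriv {ψ : Space d → ℂ} {x : Space d} (hx : x ∉ tsupport ψ)
    (i : Fin d) : partialDeriv i ψ x = 0 := by
  by_contra hne
  exact hx (tsupport_fderiv_apply_subset ℝ (EuclideanSpace.single i (1 : ℝ))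
    (subset_tsupport _ hne))

theorem IsTestFunction.memLp {m : ℕ∞} {Ω : Set (Space d)} {φ : Space d → ℂ}
    (h : IsTestFunction m Ω φ) (μ : Measure (Space d)) [IsFiniteMeasureOnCompacts μ] :
    MemLp φ 2 μ :=
  h.continuous.memLp_of_hasCompactSupport h.hasCompactSupport

theorem IsTestFunction.continuous_partialDeriv {Ω : Set (Space d)} {φ : Space d → ℂ}
    (h : IsTestFunction 1 Ω φ) (i : Fin d) : Continuous (Helmholtz.partialDeriv i φ) :=
  (h.contDiff.continuous_fderiv (by simp)).clm_apply continuous_const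

theorem IsTestFunction.memLp_partialDeriv {Ω : Set (Space d)} {φ : Space d → ℂ}
    (h : IsTestFunction 1 Ω φ) (i : Fin d) (μ : Measure (Space d)) [IsFiniteMeasureOnCompacts μ] :
    MemLp (Helmholtz.partialDeriv i φ) 2 μ :=
  (h.continuous_partialDeriv i).memLp_of_hasCompactSupport (h.hasCompactSupport.fderiv_apply ℝ _)

theorem integral_mul_partialDeriv_schwartz {Ω : Set (Space d)} {φ : Space d → ℂ}
    (h : IsTestFunction 1 Ω φ) (f : 𝓢(Space d, ℂ)) (i : Fin d) :
    ∫ x, φ x * partialDeriv i f x = -∫ x, partialDeriv i φ x * f x := by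
  refine integral_mul_fderiv_eq_neg_fderiv_mul_of_integrable
    ?_ ?_ ?_ (fun x _ => h.contDiff.differentiable (by simp) x) fun x _ => f.differentiableAt
  · exact (h.memLp_partialDeriv i volume).integrable_mul (f.memLp 2 volume)
  · exact (h.memLp volume).integrable_mul
      ((∂_{EuclideanSpace.single i (1 : ℝ)} f).memLp 2 volume)
  · exact (h.memLp volume).integrable_mul (f.memLp 2 volume)

variable {R : ℝ} {a : Space d → ℂ} {b : Fin d → Space d → ℂ}

theorem integral_add_sum_eq_zero_of_contDiff_one (hR : 0 < R)
    (ha : MemLp a 2 (volume.restrict (B d R))) (hb : ∀ i, MemLp (b i) 2 (volume.restrict (B d R)))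
    (h : ∀ φ : Space d → ℂ, IsTestFunction ⊤ (B d R) φ →
      (∫ x in B d R, a x * φ x) + ∑ i, ∫ x in B d R, b i x * partialDeriv i φ x = 0)
    {φ : Space d → ℂ} (hφ : IsTestFunction 1 (B d R) φ) :
    (∫ x in B d R, a x * φ x) + ∑ i, ∫ x in B d R, b i x * partialDeriv i φ x = 0 := by
  obtain ⟨χ, hχ, h1, h0⟩ := exists_cutoff_of_isClosed hR (isClosed_tsupport φ) hφ.tsupport_subset
  refine integral_add_sum_eq_zero_of_test measurableSet_ball ha hb h (hφ.memLp volume)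
    (fun i => hφ.memLp_partialDeriv i volume)
    (fun f i => integral_mul_partialDeriv_schwartz hφ f i) hχ ?_ ?_ ?_
  · intro x
    by_cases hx : x ∈ tsupport φ
    · rw [h1 x hx, one_mul]
    · rw [image_eq_zero_of_notMem_tsupport hx, mul_zero]
  · intro i x
    by_cases hx : x ∈ tsupport φ
    · rw [h1 x hx, one_mul]
    · rw [notMem_tsupport_partialDeriv hx, mul_zero]
  · intro i x
    by_cases hx : x ∈ tsupport φ
    · rw [h0 i x hx, zero_mul]
    · rw [image_eq_zero_of_notMem_tsupport hx, mul_zero]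

/-- Extended by zero, `ψ u` is weakly differentiable on all of `ℝ^d` with gradient `ψ G + u ∇ψ`. It
can therefore serve as a test function, as energy and flux identities require. -/
theorem integral_add_sum_eq_zero_of_isWeakGradient (hR : 0 < R)
    (ha : MemLp a 2 (volume.restrict (B d R))) (hb : ∀ i, MemLp (b i) 2 (volume.restrict (B d R)))
    (h : ∀ φ : Space d → ℂ, IsTestFunction ⊤ (B d R) φ →
      (∫ x in B d R, a x * φ x) + ∑ i, ∫ x in B d R, b i x * partialDeriv i φ x = 0)
    {u : L2 (B d R)} {G : L2Vec (B d R)} (hG : IsWeakGradient (B d R) u G)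
    {ψ : Space d → ℂ} (hψ : IsTestFunction ⊤ (B d R) ψ) :
    (∫ x in B d R, a x * (ψ x * u x))
      + ∑ i, ∫ x in B d R, b i x * (ψ x * G x i + partialDeriv i ψ x * u x) = 0 := by
  obtain ⟨χ, hχ, h1, h0⟩ := exists_cutoff_of_isClosed hR (isClosed_tsupport ψ) hψ.tsupport_subset
  have hψu : MemLp (fun x => ψ x * u x) 2 (volume.restrict (B d R)) :=
    memLp_mul_of_hasCompactSupport hψ.continuous hψ.hasCompactSupport (Lp.memLp u)
  have hψG : ∀ i, MemLp (fun x => ψ x * G x i) 2 (volume.restrict (B d R)) := fun i =>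
    memLp_mul_of_hasCompactSupport hψ.continuous hψ.hasCompactSupport (memLp_coord G i)
  have hdψu : ∀ i, MemLp (fun x => partialDeriv i ψ x * u x) 2 (volume.restrict (B d R)) :=
    fun i => memLp_mul_of_hasCompactSupport (hψ.partialDeriv i).continuous
      (hψ.partialDeriv i).hasCompactSupport (Lp.memLp u)
  have hind : ∀ (g p : Space d → ℂ), ∫ x, (B d R).indicator g x * p x
      = ∫ x in B d R, g x * p x := by
    intro g p
    rw [← integral_indicator measurableSet_ball]
    refine integral_congr_ae (ae_of_all _ fun x => ?_)
    simp only [Set.indicator]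
    split_ifs <;> simp
  have key := integral_add_sum_eq_zero_of_test measurableSet_ball ha hb h
    (v := (B d R).indicator fun x => ψ x * u x)
    (F := fun i => (B d R).indicator fun x => ψ x * G x i + partialDeriv i ψ x * u x)
    ((memLp_indicator_iff_restrict measurableSet_ball).2 hψu)
    (fun i => (memLp_indicator_iff_restrict measurableSet_ball).2 ((hψG i).add (hdψu i)))
    (fun f i => ?_) hχ ?_ ?_ ?_
  · rw [← key]
    congr 1
    · refine setIntegral_congr_fun measurableSet_ball fun x hx => ?_
      simp only [Set.indicator_of_mem hx]
    · refine Finset.sum_congr rfl fun i _ => ?_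
      refine setIntegral_congr_fun measurableSet_ball fun x hx => ?_
      simp only [Set.indicator_of_mem hx]
  · rw [hind, hind]
    have hw := hG _ (hψ.mul_contDiff (f.smooth ⊤)) i
    have e1 : ∫ x in B d R, u x * partialDeriv i (fun x => ψ x * f x) x
        = (∫ x in B d R, partialDeriv i ψ x * u x * f x)
          + ∫ x in B d R, ψ x * u x * partialDeriv i f x := by
      rw [← integral_add]
      · refine integral_congr_ae (ae_of_all _ fun x => ?_)
        simp only
        rw [partialDeriv_mul (hψ.contDiff.differentiable (by simp) x) f.differentiableAt]
        ring
      · exact (hdψu i).integrable_mul ((f.memLp 2 volume).restrict _)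
      · exact hψu.integrable_mul
          (((∂_{EuclideanSpace.single i (1 : ℝ)} f).memLp 2 volume).restrict _)
    have e2 : ∫ x in B d R, (ψ x * G x i + partialDeriv i ψ x * u x) * f x
        = (∫ x in B d R, G x i * (ψ x * f x)) + ∫ x in B d R, partialDeriv i ψ x * u x * f x := by
      rw [← integral_add]
      · refine integral_congr_ae (ae_of_all _ fun x => ?_)
        simp only
        ring
      · refine ((hψG i).integrable_mul ((f.memLp 2 volume).restrict _)).congr
          (ae_of_all _ fun x => ?_)
        simp only [Pi.mul_apply]
        ring
      · exact (hdψu i).integrable_mul ((f.memLp 2 volume).restrict _)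
    rw [e2]
    rw [e1] at hw
    linear_combination hw
  · intro x
    by_cases hx : x ∈ tsupport ψ
    · rw [h1 x hx, one_mul]
    · simp [Set.indicator, image_eq_zero_of_notMem_tsupport hx]
  · intro i x
    by_cases hx : x ∈ tsupport ψ
    · rw [h1 x hx, one_mul]
    · simp [Set.indicator, image_eq_zero_of_notMem_tsupport hx, notMem_tsupport_partialDeriv hx]
  · intro i x
    by_cases hx : x ∈ tsupport ψ
    · rw [h0 i x hx, zero_mul]
    · simp [Set.indicator, image_eq_zero_of_notMem_tsupport hx]

end Extension

/-! ### Integration by parts estimates for Schwartz functions. -/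

section SchwartzEstimates

variable {d : ℕ}

theorem inner_toLp (f g : 𝓢(Space d, ℂ)) :
    inner ℝ (f.toLp 2 volume) (g.toLp 2 volume) = ∫ x, inner ℝ (f x) (g x) := by
  rw [L2.inner_def]
  refine integral_congr_ae ?_
  filter_upwards [f.coeFn_toLp 2, g.coeFn_toLp 2] with x h1 h2
  rw [h1, h2]

theorem inner_lineDerivOp_right (f g : 𝓢(Space d, ℂ)) (m : Space d) :
    inner ℝ (f.toLp 2 volume) ((∂_{m} g).toLp 2 volume)
      = -inner ℝ ((∂_{m} f).toLp 2 volume) (g.toLp 2 volume) := by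
  rw [inner_toLp, inner_toLp]
  exact SchwartzMap.integral_bilinear_lineDerivOp_right_eq_neg_left f g (innerSL ℝ) m

theorem inner_self_lineDerivOp (f : 𝓢(Space d, ℂ)) (m : Space d) :
    inner ℝ (f.toLp 2 volume) ((∂_{m} f).toLp 2 volume) = 0 := by
  have h := inner_lineDerivOp_right f f m
  rw [real_inner_comm (f.toLp 2 volume)] at h
  linarith

theorem lineDerivOp_comm (f : 𝓢(Space d, ℂ)) (m n : Space d) :
    ∂_{m} (∂_{n} f) = ∂_{n} (∂_{m} f) := by
  ext x
  have h : ∀ m n : Space d, ∂_{m} (∂_{n} f) x = fderiv ℝ (fderiv ℝ f) x m n := by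
    intro m n
    have hd : DifferentiableAt ℝ (fderiv ℝ f) x :=
      ((f.smooth ⊤).fderiv_right (m := ((⊤ : ℕ∞) : WithTop ℕ∞))
        (by simp)).differentiable (by simp) x
    change fderiv ℝ (fun y => fderiv ℝ f y n) x m = _
    rw [fderiv_clm_apply hd (differentiableAt_const n)]
    simp
  rw [h, h]
  exact ((f.smooth 2).contDiffAt.isSymmSndFDerivAt (by simp)).eq m n

theorem toLp_laplacian (f : 𝓢(Space d, ℂ)) : (Δ f).toLp 2 volume
    = ∑ i : Fin d, (∂_{EuclideanSpace.single i (1 : ℝ)}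
        (∂_{EuclideanSpace.single i (1 : ℝ)} f)).toLp 2 volume := by
  simp only [← SchwartzMap.toLpCLM_apply (𝕜 := ℂ)]
  rw [SchwartzMap.laplacian_eq_sum (EuclideanSpace.basisFun (Fin d) ℝ), map_sum]
  simp

/-- One integration by parts in each `∂_i ∂_i` leaves `⟨∂_m g, g⟩` with `g = ∂_i f`, which is zero
because `∂_m` is skew. -/
theorem inner_laplacian_lineDerivOp (f : 𝓢(Space d, ℂ)) (m : Space d) :
    inner ℝ ((Δ f).toLp 2 volume) ((∂_{m} f).toLp 2 volume) = 0 := by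
  rw [toLp_laplacian, sum_inner]
  refine Finset.sum_eq_zero fun i _ => ?_
  rw [real_inner_comm, inner_lineDerivOp_right, lineDerivOp_comm, real_inner_comm,
    inner_self_lineDerivOp, neg_zero]

/-- For a unit vector `m` the operator is `e^{τ x·m} Δ e^{-τ x·m}`. Paired with `∂_m w`, its
symmetric part `Δ + τ²` contributes nothing and only `-2τ ‖∂_m w‖²` survives; Cauchy-Schwarz
concludes. -/
theorem norm_lineDerivOp_le_conjugated (w : 𝓢(Space d, ℂ)) (m : Space d) {τ : ℝ} (hτ : 0 < τ) :
    2 * τ * ‖(∂_{m} w).toLp 2 volume‖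
      ≤ ‖(Δ w - (2 * τ) • ∂_{m} w + τ ^ 2 • w).toLp 2 volume‖ := by
  set P := (Δ w - (2 * τ) • ∂_{m} w + τ ^ 2 • w).toLp 2 volume with hP
  have hP' : P = (Δ w).toLp 2 volume - (2 * τ) • (∂_{m} w).toLp 2 volume
      + τ ^ 2 • w.toLp 2 volume := rfl
  have h : inner ℝ P ((∂_{m} w).toLp 2 volume)
      = -(2 * τ) * ‖(∂_{m} w).toLp 2 volume‖ ^ 2 := by
    rw [hP', inner_add_left, inner_sub_left, real_inner_smul_left, real_inner_smul_left,
      inner_laplacian_lineDerivOp, inner_self_lineDerivOp, real_inner_self_eq_norm_sq]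
    ring
  have h2 := abs_real_inner_le_norm P ((∂_{m} w).toLp 2 volume)
  rw [h, abs_mul, abs_neg, abs_of_pos (by positivity : 0 < 2 * τ), abs_of_nonneg (by positivity)]
    at h2
  rcases (norm_nonneg ((∂_{m} w).toLp 2 volume)).eq_or_lt with h0 | h0
  · rw [← h0, mul_zero]
    exact norm_nonneg _
  · nlinarith

/-- Poincaré inequality: `∂_i (x_i w) = w + x_i ∂_i w` gives `‖w‖² = -2 ⟨x_i w, ∂_i w⟩`, and `|x_i|
≤ R` where `w ≠ 0`. -/
theorem norm_le_lineDerivOp (w : 𝓢(Space d, ℂ)) (i : Fin d) {R : ℝ} (hR : 0 ≤ R)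
    (hw : ∀ x, w x ≠ 0 → ‖x‖ ≤ R) :
    ‖w.toLp 2 volume‖
      ≤ 2 * R * ‖(∂_{EuclideanSpace.single i (1 : ℝ)} w).toLp 2 volume‖ := by
  have hg : (fun x : Space d => x i).HasTemperateGrowth :=
    (EuclideanSpace.proj i : Space d →L[ℝ] ℝ).hasTemperateGrowth
  set m : Space d := EuclideanSpace.single i (1 : ℝ) with hm
  let M := SchwartzMap.smulLeftCLM ℂ (fun x : Space d => x i)
  have hM : ∀ (f : 𝓢(Space d, ℂ)) x, M f x = x i • f x :=
    SchwartzMap.smulLeftCLM_apply_apply hg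
  have hMw : ‖(M w).toLp 2 volume‖ ≤ R * ‖w.toLp 2 volume‖ := by
    refine Lp.norm_le_mul_norm_of_ae_le_mul ?_
    filter_upwards [(M w).coeFn_toLp 2, w.coeFn_toLp 2] with x h1 h2
    rw [h1, h2, hM, norm_smul]
    by_cases hx : w x = 0
    · simp [hx]
    · exact mul_le_mul_of_nonneg_right ((PiLp.norm_apply_le x i).trans (hw x hx)) (norm_nonneg _)
  have hd : ∂_{m} (M w) = w + M (∂_{m} w) := by
    ext x
    have hf : HasFDerivAt (M w) (x i • fderiv ℝ w x
        + (EuclideanSpace.proj i : Space d →L[ℝ] ℝ).smulRight (w x)) x := by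
      have : (M w : Space d → ℂ) = fun x => x i • w x := funext (hM w)
      rw [this]
      exact ((EuclideanSpace.proj i : Space d →L[ℝ] ℝ).hasFDerivAt).smul (w.hasFDerivAt x)
    rw [SchwartzMap.lineDerivOp_apply_eq_fderiv, hf.fderiv]
    change _ = w x + M (∂_{m} w) x
    rw [hM, SchwartzMap.lineDerivOp_apply_eq_fderiv]
    simp [hm]
    ring
  have h1 := inner_lineDerivOp_right (M w) w m
  have h2 : ((∂_{m} (M w)).toLp 2 volume) = w.toLp 2 volume + (M (∂_{m} w)).toLp 2 volume := by
    rw [hd]; rfl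
  have h3 : inner ℝ ((M (∂_{m} w)).toLp 2 volume) (w.toLp 2 volume)
      = inner ℝ ((M w).toLp 2 volume) ((∂_{m} w).toLp 2 volume) := by
    rw [inner_toLp, inner_toLp]
    refine integral_congr_ae (ae_of_all _ fun x => ?_)
    simp only [hM]
    rw [real_inner_smul_left, real_inner_smul_left, real_inner_comm]
  rw [h2, inner_add_left, real_inner_self_eq_norm_sq, h3] at h1
  have h4 := abs_real_inner_le_norm ((M w).toLp 2 volume) ((∂_{m} w).toLp 2 volume)
  have h5 := neg_abs_le (inner ℝ ((M w).toLp 2 volume) ((∂_{m} w).toLp 2 volume))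
  rcases (norm_nonneg (w.toLp 2 volume)).eq_or_lt with h0 | h0
  · have hw0 : 0 ≤ R * ‖(∂_{m} w).toLp 2 volume‖ := by positivity
    linarith
  · have h6 := mul_le_mul_of_nonneg_right hMw (norm_nonneg ((∂_{m} w).toLp 2 volume))
    nlinarith

/-- Pairing with `g` gives `‖g‖² + ∑ ‖∂_j g‖² = -⟨∂_i g, f⟩`. This first bounds `‖∂_i g‖` by `‖f‖`,
and then every term on the left. -/
theorem norm_le_of_sub_laplacian_eq {f g : 𝓢(Space d, ℂ)} {i : Fin d}
    (h : g - Δ g = ∂_{EuclideanSpace.single i (1 : ℝ)} f) :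
    ‖g.toLp 2 volume‖ ≤ ‖f.toLp 2 volume‖ ∧ ∀ j : Fin d,
      ‖(∂_{EuclideanSpace.single j (1 : ℝ)} g).toLp 2 volume‖ ≤ ‖f.toLp 2 volume‖ := by
  have h1 : inner ℝ (g.toLp 2 volume) (g.toLp 2 volume) - inner ℝ (g.toLp 2 volume)
      ((Δ g).toLp 2 volume) = inner ℝ (g.toLp 2 volume)
        ((∂_{EuclideanSpace.single i (1 : ℝ)} f).toLp 2 volume) := by
    rw [← inner_sub_right, ← h]; rfl
  rw [toLp_laplacian, inner_sum, inner_lineDerivOp_right g f, real_inner_self_eq_norm_sq] at h1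
  simp only [inner_lineDerivOp_right g, real_inner_self_eq_norm_sq, Finset.sum_neg_distrib,
    sub_neg_eq_add] at h1
  have h2 := neg_abs_le (inner ℝ ((∂_{EuclideanSpace.single i (1 : ℝ)} g).toLp 2 volume)
    (f.toLp 2 volume))
  have h3 := abs_real_inner_le_norm ((∂_{EuclideanSpace.single i (1 : ℝ)} g).toLp 2 volume)
    (f.toLp 2 volume)
  have h4 : ∀ j : Fin d, ‖(∂_{EuclideanSpace.single j (1 : ℝ)} g).toLp 2 volume‖ ^ 2
      ≤ ∑ j : Fin d, ‖(∂_{EuclideanSpace.single j (1 : ℝ)} g).toLp 2 volume‖ ^ 2 := fun j =>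
    Finset.single_le_sum
      (f := fun j : Fin d => ‖(∂_{EuclideanSpace.single j (1 : ℝ)} g).toLp 2 volume‖ ^ 2)
      (fun _ _ => by positivity) (Finset.mem_univ j)
  have hi : ‖(∂_{EuclideanSpace.single i (1 : ℝ)} g).toLp 2 volume‖ ≤ ‖f.toLp 2 volume‖ := by
    have := h4 i
    nlinarith [norm_nonneg (f.toLp 2 volume), norm_nonneg (g.toLp 2 volume),
      norm_nonneg ((∂_{EuclideanSpace.single i (1 : ℝ)} g).toLp 2 volume)]
  have h5 := mul_le_mul_of_nonneg_right hi (norm_nonneg (f.toLp 2 volume))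
  refine ⟨?_, fun j => ?_⟩
  · refine abs_le_of_sq_le_sq' ?_ (norm_nonneg _) |>.2
    have := h4 i
    nlinarith [sq_nonneg ‖(∂_{EuclideanSpace.single i (1 : ℝ)} g).toLp 2 volume‖]
  · refine abs_le_of_sq_le_sq' ?_ (norm_nonneg _) |>.2
    have := h4 j
    nlinarith [sq_nonneg ‖g.toLp 2 volume‖]

end SchwartzEstimates

/-! ### Carleman estimate with a linear weight. -/

section Carleman

variable {d : ℕ}

/-- The classical Laplacian, as a sum of second partial derivatives. -/
def lap (φ : Space d → ℂ) (x : Space d) : ℂ := ∑ i, partialDeriv i (partialDeriv i φ) x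

theorem laplacian_schwartz_apply (f : 𝓢(Space d, ℂ)) (x : Space d) : Δ f x = lap f x := by
  rw [SchwartzMap.laplacian_eq_sum (EuclideanSpace.basisFun (Fin d) ℝ), sum_apply, lap]
  refine Finset.sum_congr rfl fun i _ => ?_
  rw [EuclideanSpace.basisFun_apply]
  rfl

theorem contDiff_partialDeriv {φ : Space d → ℂ} (h : ContDiff ℝ ((⊤ : ℕ∞) : WithTop ℕ∞) φ)
    (i : Fin d) : ContDiff ℝ ((⊤ : ℕ∞) : WithTop ℕ∞) (partialDeriv i φ) :=
  (h.fderiv_right (m := ((⊤ : ℕ∞) : WithTop ℕ∞)) (by simp)).clm_apply contDiff_const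

theorem IsTestFunction.lap {Ω : Set (Space d)} {φ : Space d → ℂ} (h : IsTestFunction ⊤ Ω φ) :
    IsTestFunction ⊤ Ω (lap φ) := by
  have hs : tsupport (Helmholtz.lap φ) ⊆ tsupport φ := by
    refine closure_minimal (fun x hx => ?_) (isClosed_tsupport φ)
    by_contra hne
    refine hx (Finset.sum_eq_zero fun i _ => ?_)
    refine notMem_tsupport_partialDeriv (fun h2 => hne ?_) i
    exact tsupport_fderiv_apply_subset ℝ (EuclideanSpace.single i (1 : ℝ)) h2
  exact ⟨ContDiff.sum fun i _ => contDiff_partialDeriv (contDiff_partialDeriv h.contDiff i) i,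
    h.hasCompactSupport.of_isClosed_subset (isClosed_tsupport _) hs, hs.trans h.tsupport_subset⟩

theorem partialDeriv_add {f g : Space d → ℂ} {x : Space d} (hf : DifferentiableAt ℝ f x)
    (hg : DifferentiableAt ℝ g x) (i : Fin d) :
    partialDeriv i (fun x => f x + g x) x = partialDeriv i f x + partialDeriv i g x := by
  simp only [partialDeriv]
  rw [fderiv_fun_add hf hg]
  simp

theorem partialDeriv_const_mul {f : Space d → ℂ} {x : Space d} (hf : DifferentiableAt ℝ f x)
    (c : ℂ) (i : Fin d) :
    partialDeriv i (fun x => c * f x) x = c * partialDeriv i f x := by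
  simp only [partialDeriv]
  rw [fderiv_const_mul hf]
  simp

theorem lap_mul {f g : Space d → ℂ} (hf : ContDiff ℝ ((⊤ : ℕ∞) : WithTop ℕ∞) f)
    (hg : ContDiff ℝ ((⊤ : ℕ∞) : WithTop ℕ∞) g) (x : Space d) :
    lap (fun x => f x * g x) x
      = lap f x * g x + 2 * ∑ i, partialDeriv i f x * partialDeriv i g x + f x * lap g x := by
  simp only [lap, Finset.sum_mul, Finset.mul_sum, ← Finset.sum_add_distrib]
  refine Finset.sum_congr rfl fun i _ => ?_
  have hf1 := fun x => hf.differentiable (by simp) x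
  have hg1 := fun x => hg.differentiable (by simp) x
  have hf2 := fun x => (contDiff_partialDeriv hf i).differentiable (by simp) x
  have hg2 := fun x => (contDiff_partialDeriv hg i).differentiable (by simp) x
  have h1 : partialDeriv i (fun x => f x * g x)
      = fun x => partialDeriv i f x * g x + f x * partialDeriv i g x :=
    funext fun x => partialDeriv_mul (hf1 x) (hg1 x) i
  rw [h1, partialDeriv_add ((hf2 x).fun_mul (hg1 x)) ((hf1 x).fun_mul (hg2 x)),
    partialDeriv_mul (hf2 x) (hg1 x), partialDeriv_mul (hf1 x) (hg2 x)]
  ring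

/-- The exponential weight `x ↦ exp (τ x_i)`. -/
def expWeight (τ : ℝ) (i : Fin d) (x : Space d) : ℂ := (Real.exp (τ * x i) : ℝ)

theorem contDiff_expWeight (τ : ℝ) (i : Fin d) :
    ContDiff ℝ ((⊤ : ℕ∞) : WithTop ℕ∞) (expWeight τ i) := by
  have : ContDiff ℝ ((⊤ : ℕ∞) : WithTop ℕ∞) fun x : Space d => x i :=
    (EuclideanSpace.proj i : Space d →L[ℝ] ℝ).contDiff
  exact Complex.ofRealCLM.contDiff.comp (Real.contDiff_exp.comp (contDiff_const.mul this))

theorem partialDeriv_expWeight (τ : ℝ) (i j : Fin d) :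
    partialDeriv j (expWeight τ i)
      = fun x => (if j = i then (τ : ℂ) else 0) * expWeight τ i x := by
  ext x
  have h0 : HasFDerivAt (fun x : Space d => x i) (EuclideanSpace.proj i : Space d →L[ℝ] ℝ) x :=
    (EuclideanSpace.proj i : Space d →L[ℝ] ℝ).hasFDerivAt
  have h := Complex.ofRealCLM.hasFDerivAt.comp x ((h0.const_mul τ).exp)
  have h' : partialDeriv j (expWeight τ i) x = _ :=
    congrArg (fun L : Space d →L[ℝ] ℂ => L (EuclideanSpace.single j (1 : ℝ))) h.fderiv
  rw [h']
  simp [expWeight, eq_comm (a := i)]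
  split_ifs <;> simp [mul_comm]

theorem lap_expWeight (τ : ℝ) (i : Fin d) (x : Space d) :
    lap (expWeight τ i) x = τ ^ 2 * expWeight τ i x := by
  rw [lap, Finset.sum_eq_single i]
  · rw [partialDeriv_expWeight, partialDeriv_const_mul
      ((contDiff_expWeight τ i).differentiable (by simp) x), partialDeriv_expWeight]
    simp
    ring
  · intro j _ hj
    rw [partialDeriv_expWeight, if_neg hj]
    simp [partialDeriv]
  · simp

/-- For `w = e^{τ x_i} φ`, the weighted Laplacian of `φ` is the conjugated operator applied to `w`;
its lower bound combines with the Poincaré inequality. -/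
theorem norm_expWeight_mul_le {R τ : ℝ} (hR : 0 < R) (hτ : 0 < τ) (i : Fin d) {φ : Space d → ℂ}
    (hφ : IsTestFunction ⊤ (B d R) φ) :
    τ * (eLpNorm (fun x => expWeight τ i x * φ x) 2 volume).toReal
      ≤ R * (eLpNorm (fun x => expWeight τ i x * lap φ x) 2 volume).toReal := by
  have hw : IsTestFunction ⊤ (B d R) fun x => expWeight τ i x * φ x := by
    simpa only [mul_comm] using hφ.mul_contDiff (contDiff_expWeight τ i)
  let w : 𝓢(Space d, ℂ) := hw.hasCompactSupport.toSchwartzMap hw.contDiff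
  have hwa : ∀ x, w x = expWeight τ i x * φ x := fun x => rfl
  set m : Space d := EuclideanSpace.single i (1 : ℝ) with hm
  have hP : (Δ w - (2 * τ) • ∂_{m} w + τ ^ 2 • w : Space d → ℂ)
      = fun x => expWeight τ i x * lap φ x := by
    ext x
    have h1 : Δ w x = lap (fun x => expWeight τ i x * φ x) x := laplacian_schwartz_apply w x
    have h2 : ∂_{m} w x = partialDeriv i (fun x => expWeight τ i x * φ x) x := rfl
    change Δ w x - (2 * τ) • ∂_{m} w x + τ ^ 2 • w x = _
    rw [h1, h2, hwa, lap_mul (contDiff_expWeight τ i) hφ.contDiff, lap_expWeight,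
      partialDeriv_mul ((contDiff_expWeight τ i).differentiable (by simp) x)
        (hφ.contDiff.differentiable (by simp) x)]
    simp only [partialDeriv_expWeight, ite_mul, zero_mul, Finset.sum_ite_eq', Finset.mem_univ,
      if_true, Complex.real_smul]
    push_cast
    ring
  have h1 := norm_lineDerivOp_le_conjugated w m hτ
  have h2 := norm_le_lineDerivOp w i hR.le fun x hx => by
    have : x ∈ tsupport φ := subset_tsupport _ (right_ne_zero_of_mul (hwa x ▸ hx))
    exact (mem_ball_zero_iff.1 (hφ.tsupport_subset this)).le
  rw [SchwartzMap.norm_toLp] at h2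
  have h3 : ‖(Δ w - (2 * τ) • ∂_{m} w + τ ^ 2 • w).toLp 2 volume‖
      = (eLpNorm (fun x => expWeight τ i x * lap φ x) 2 volume).toReal := by
    rw [SchwartzMap.norm_toLp]
    exact congrArg (fun g => (eLpNorm g 2 volume).toReal) hP
  rw [h3] at h1
  calc _ ≤ τ * (2 * R * ‖(∂_{m} w).toLp 2 volume‖) := mul_le_mul_of_nonneg_left h2 hτ.le
    _ = R * (2 * τ * ‖(∂_{m} w).toLp 2 volume‖) := by ring
    _ ≤ _ := mul_le_mul_of_nonneg_left h1 hR.le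

theorem toReal_eLpNorm_le_mul {X E F : Type*} [MeasurableSpace X] [NormedAddCommGroup E]
    [NormedAddCommGroup F] {μ : Measure X} {a : X → E} {b : X → F} (hb : MemLp b 2 μ) {C : ℝ} (hC : 0 ≤ C) (h : ∀ᵐ x ∂μ, ‖a x‖ ≤ C * ‖b x‖) :
    (eLpNorm a 2 μ).toReal ≤ C * (eLpNorm b 2 μ).toReal := by
  have := ENNReal.toReal_mono (ENNReal.mul_ne_top ENNReal.ofReal_ne_top hb.2.ne)
    (eLpNorm_le_mul_eLpNorm_of_ae_le_mul h 2)
  rwa [ENNReal.toReal_mul, ENNReal.toReal_ofReal hC] at this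

theorem toReal_eLpNorm_add_le {X : Type*} [MeasurableSpace X] {μ : Measure X} {a b : X → ℂ}
    (ha : MemLp a 2 μ) (hb : MemLp b 2 μ) :
    (eLpNorm (fun x => a x + b x) 2 μ).toReal
      ≤ (eLpNorm a 2 μ).toReal + (eLpNorm b 2 μ).toReal := by
  rw [← ENNReal.toReal_add ha.2.ne hb.2.ne]
  exact ENNReal.toReal_mono (ENNReal.add_ne_top.2 ⟨ha.2.ne, hb.2.ne⟩)
    (eLpNorm_add_le ha.1 hb.1 one_le_two)

theorem memLp_mul_of_ae_bound {X : Type*} [MeasurableSpace X] {μ : Measure X} {V a : X → ℂ} {M : ℝ}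
    (hV : AEStronglyMeasurable V μ) (hM : ∀ᵐ x ∂μ, ‖V x‖ ≤ M) (ha : MemLp a 2 μ) :
    MemLp (fun x => V x * a x) 2 μ := by
  refine ha.of_le_mul (c := M) (hV.mul ha.1) ?_
  filter_upwards [hM] with x hx
  rw [norm_mul]
  exact mul_le_mul_of_nonneg_right hx (norm_nonneg _)

/-- The `L²` norm of a test function is controlled by that of `Δφ + Vφ`. -/
theorem exists_norm_le_lap_add_mul {R : ℝ} (hR : 0 < R) (i : Fin d) {V : Space d → ℂ} {M : ℝ}
    (hM0 : 0 ≤ M) (hV : AEStronglyMeasurable V volume) (hM : ∀ᵐ x, ‖V x‖ ≤ M) :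
    ∃ C : ℝ, ∀ φ : Space d → ℂ, IsTestFunction ⊤ (B d R) φ →
      (eLpNorm φ 2 volume).toReal
        ≤ C * (eLpNorm (fun x => lap φ x + V x * φ x) 2 volume).toReal := by
  -- The Carleman bound gives `τ ‖w‖ ≤ R (‖e^{τ x_i} (Δ + V) φ‖ + M ‖w‖)` for `w = e^{τ x_i} φ`.
  -- With this `τ` the potential is absorbed and the remaining coefficient is exactly `1`.
  have hτ : 0 < R * (M + 1) := by positivity
  set τ := R * (M + 1) with hτd
  -- One factor removes the weight from `φ`, the other bounds it on the right-hand side.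
  refine ⟨Real.exp (τ * R) * Real.exp (τ * R), fun φ hφ => ?_⟩
  have hw : IsTestFunction ⊤ (B d R) fun x => expWeight τ i x * φ x := by
    simpa only [mul_comm] using hφ.mul_contDiff (contDiff_expWeight τ i)
  have hVφ := memLp_mul_of_ae_bound hV hM (hφ.memLp volume)
  have hVw := memLp_mul_of_ae_bound hV hM (hw.memLp volume)
  have hP : MemLp (fun x => lap φ x + V x * φ x) 2 volume := (hφ.lap.memLp volume).add hVφ
  have hx : ∀ x ∈ B d R, |x i| ≤ R := fun x hx =>
    (PiLp.norm_apply_le x i).trans (mem_ball_zero_iff.1 hx).le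
  have hnorm : ∀ x, ‖expWeight τ i x‖ = Real.exp (τ * x i) := fun x => by
    rw [expWeight, Complex.norm_real, Real.norm_of_nonneg (Real.exp_pos _).le]
  have hPB : ∀ x, x ∉ B d R → lap φ x + V x * φ x = 0 := fun x hx => by
    rw [image_eq_zero_of_notMem_tsupport fun h => hx (hφ.lap.tsupport_subset h),
      image_eq_zero_of_notMem_tsupport fun h => hx (hφ.tsupport_subset h)]
    simp
  have hwP : ∀ x, ‖expWeight τ i x * (lap φ x + V x * φ x)‖
      ≤ Real.exp (τ * R) * ‖lap φ x + V x * φ x‖ := fun x => by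
    by_cases hxB : x ∈ B d R
    · rw [norm_mul, hnorm]
      gcongr
      exact (le_abs_self _).trans (hx x hxB)
    · simp [hPB x hxB]
  have hwPm : MemLp (fun x => expWeight τ i x * (lap φ x + V x * φ x)) 2 volume :=
    hP.of_le_mul ((contDiff_expWeight τ i).continuous.aestronglyMeasurable.mul hP.1)
      (ae_of_all _ hwP)
  have h1 := norm_expWeight_mul_le hR hτ i hφ
  have h2 : (eLpNorm (fun x => expWeight τ i x * lap φ x) 2 volume).toReal
      ≤ (eLpNorm (fun x => expWeight τ i x * (lap φ x + V x * φ x)) 2 volume).toReal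
        + M * (eLpNorm (fun x => expWeight τ i x * φ x) 2 volume).toReal := by
    have e : (fun x => expWeight τ i x * lap φ x)
        = fun x => expWeight τ i x * (lap φ x + V x * φ x)
          + (-1 : ℂ) * (V x * (expWeight τ i x * φ x)) := by
      ext x; ring
    rw [e]
    refine (toReal_eLpNorm_add_le hwPm (hVw.const_mul _)).trans ?_
    gcongr
    refine toReal_eLpNorm_le_mul (hw.memLp volume) hM0 ?_
    filter_upwards [hM] with x hx
    rw [norm_mul, norm_mul (V x)]
    simpa using mul_le_mul_of_nonneg_right hx (norm_nonneg (expWeight τ i x * φ x))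
  have h3 := toReal_eLpNorm_le_mul hP (Real.exp_pos (τ * R)).le (ae_of_all _ hwP)
  have h4 : (eLpNorm φ 2 volume).toReal
      ≤ Real.exp (τ * R) * (eLpNorm (fun x => expWeight τ i x * φ x) 2 volume).toReal := by
    refine toReal_eLpNorm_le_mul (hw.memLp volume) (Real.exp_pos _).le (ae_of_all _ fun x => ?_)
    by_cases hxB : x ∈ B d R
    · rw [norm_mul, hnorm, ← mul_assoc, ← Real.exp_add]
      refine le_mul_of_one_le_left (norm_nonneg _) (Real.one_le_exp ?_)
      have := neg_abs_le (x i)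
      have := hx x hxB
      nlinarith
    · rw [image_eq_zero_of_notMem_tsupport fun h => hxB (hφ.tsupport_subset h)]
      simp
  have h5 : (eLpNorm (fun x => expWeight τ i x * φ x) 2 volume).toReal
      ≤ (eLpNorm (fun x => expWeight τ i x * (lap φ x + V x * φ x)) 2 volume).toReal := by
    have h6 := h1.trans (mul_le_mul_of_nonneg_left h2 hR.le)
    rw [hτd, mul_assoc] at h6
    have h7 := le_of_mul_le_mul_left h6 hR
    rw [← hτd] at h7
    linarith
  calc _ ≤ _ := h4
    _ ≤ Real.exp (τ * R) * (Real.exp (τ * R)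
        * (eLpNorm (fun x => lap φ x + V x * φ x) 2 volume).toReal) := by gcongr; exact h5.trans h3
    _ = _ := by ring

end Carleman

/-! ### Solvability by duality, and interior regularity. -/

section Existence

theorem integrable_mul_of_memLp {X : Type*} [MeasurableSpace X] {μ : Measure X} {a b : X → ℂ}
    (ha : MemLp a 2 μ) (hb : MemLp b 2 μ) : Integrable (fun x => a x * b x) μ :=
  ha.integrable_mul hb

variable {d : ℕ}

/-- Smooth functions with compact support in `Ω`, as a complex vector space. -/
def testSpace (Ω : Set (Space d)) : Submodule ℂ (Space d → ℂ) where
  carrier := {φ | IsTestFunction ⊤ Ω φ}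
  add_mem' := fun {f g} hf hg => ⟨hf.contDiff.add hg.contDiff,
    hf.hasCompactSupport.add hg.hasCompactSupport,
    (tsupport_add f g).trans (Set.union_subset hf.tsupport_subset hg.tsupport_subset)⟩
  zero_mem' := ⟨contDiff_const, HasCompactSupport.zero, by simp⟩
  smul_mem' := fun c f hf => ⟨contDiff_const.smul hf.contDiff, hf.hasCompactSupport.smul_left,
    (closure_mono (Function.support_const_smul_subset c f)).trans hf.tsupport_subset⟩

theorem lap_add {f g : Space d → ℂ} (hf : ContDiff ℝ ((⊤ : ℕ∞) : WithTop ℕ∞) f)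
    (hg : ContDiff ℝ ((⊤ : ℕ∞) : WithTop ℕ∞) g) (x : Space d) :
    lap (f + g) x = lap f x + lap g x := by
  simp only [lap, ← Finset.sum_add_distrib]
  refine Finset.sum_congr rfl fun i _ => ?_
  have h1 : partialDeriv i (f + g) = fun x => partialDeriv i f x + partialDeriv i g x :=
    funext fun x => partialDeriv_add (hf.differentiable (by simp) x)
      (hg.differentiable (by simp) x) i
  rw [h1, partialDeriv_add ((contDiff_partialDeriv hf i).differentiable (by simp) x)
    ((contDiff_partialDeriv hg i).differentiable (by simp) x)]

theorem lap_smul {f : Space d → ℂ} (hf : ContDiff ℝ ((⊤ : ℕ∞) : WithTop ℕ∞) f) (c : ℂ)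
    (x : Space d) : lap (c • f) x = c * lap f x := by
  simp only [lap, Finset.mul_sum]
  refine Finset.sum_congr rfl fun i _ => ?_
  have h1 : partialDeriv i (c • f) = fun x => c * partialDeriv i f x :=
    funext fun x => partialDeriv_const_mul (hf.differentiable (by simp) x) c i
  rw [h1, partialDeriv_const_mul ((contDiff_partialDeriv hf i).differentiable (by simp) x)]

/-- `Δu + Vu = f` is solvable in `L²`, in the sense of distributions in a ball. -/
theorem exists_distributional_solution {R : ℝ} (hR : 0 < R) (i : Fin d) {V f : Space d → ℂ} {M : ℝ}
    (hM0 : 0 ≤ M) (hV : AEStronglyMeasurable V volume) (hM : ∀ᵐ x, ‖V x‖ ≤ M)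
    (hf : MemLp f 2 volume) :
    ∃ u : Lp ℂ 2 (volume : Measure (Space d)), ∀ φ : Space d → ℂ, IsTestFunction ⊤ (B d R) φ →
      ∫ x, u x * (lap φ x + V x * φ x) = ∫ x, f x * φ x := by
  obtain ⟨C, hC⟩ := exists_norm_le_lap_add_mul hR i hM0 hV hM
  have hP : ∀ φ : testSpace (B d R), MemLp (fun x => lap φ.1 x + V x * φ.1 x) 2 volume :=
    fun φ => (φ.2.lap.memLp volume).add (memLp_mul_of_ae_bound hV hM (φ.2.memLp volume))
  let A : testSpace (B d R) →ₗ[ℂ] Lp ℂ 2 (volume : Measure (Space d)) :=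
    { toFun := fun φ => (hP φ).toLp _
      map_add' := fun φ ψ => by
        rw [← MemLp.toLp_add]
        congr 1
        ext x
        simp only [Submodule.coe_add, Pi.add_apply, lap_add φ.2.contDiff ψ.2.contDiff]
        ring
      map_smul' := fun c φ => by
        rw [RingHom.id_apply, ← MemLp.toLp_const_smul]
        congr 1
        ext x
        simp only [Submodule.coe_smul, Pi.smul_apply, lap_smul φ.2.contDiff, smul_eq_mul]
        ring }
  let l : testSpace (B d R) →ₗ[ℂ] ℂ :=
    { toFun := fun φ => ∫ x, f x * φ.1 x
      map_add' := fun φ ψ => by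
        rw [← integral_add (integrable_mul_of_memLp hf (φ.2.memLp volume))
          (integrable_mul_of_memLp hf (ψ.2.memLp volume))]
        refine integral_congr_ae (ae_of_all _ fun x => ?_)
        simp only [Submodule.coe_add, Pi.add_apply]
        ring
      map_smul' := fun c φ => by
        rw [RingHom.id_apply, smul_eq_mul, ← integral_const_mul]
        refine integral_congr_ae (ae_of_all _ fun x => ?_)
        simp only [Submodule.coe_smul, Pi.smul_apply, smul_eq_mul]
        ring }
  -- `Δ + V` is its own transpose for the bilinear pairing, so the a priori estimate on test
  -- functions is exactly the bound needed for duality.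
  obtain ⟨u, hu⟩ := exists_integral_mul_eq A l ((eLpNorm f 2 volume).toReal * C) fun φ => by
    have h1 : ‖A φ‖ = (eLpNorm (fun x => lap φ.1 x + V x * φ.1 x) 2 volume).toReal :=
      Lp.norm_toLp _ (hP φ)
    rw [h1, mul_assoc]
    exact (norm_integral_mul_le hf (φ.2.memLp volume)).trans
      (mul_le_mul_of_nonneg_left (hC φ.1 φ.2) ENNReal.toReal_nonneg)
  refine ⟨u, fun φ hφ => ?_⟩
  refine Eq.trans ?_ (hu ⟨φ, hφ⟩).symm
  refine integral_congr_ae ?_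
  filter_upwards [(hP ⟨φ, hφ⟩).coeFn_toLp] with x hx
  exact congrArg (u x * ·) hx.symm

/-- Interior regularity: an `L²` function with distributional Laplacian in `L²` has a weak
gradient in `L²` in smaller balls. -/
theorem exists_weak_partialDeriv {r R : ℝ} (hr : 0 < r) (hrR : r < R) {u g : Space d → ℂ}
    (hu : MemLp u 2 volume) (hg : MemLp g 2 volume)
    (h : ∀ φ : Space d → ℂ, IsTestFunction ⊤ (B d R) φ → ∫ x, u x * lap φ x = ∫ x, g x * φ x)
    (i : Fin d) :
    ∃ w : Lp ℂ 2 (volume : Measure (Space d)), ∀ φ : Space d → ℂ, IsTestFunction ⊤ (B d r) φ →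
      ∫ x, u x * partialDeriv i φ x = ∫ x, w x * φ x := by
  obtain ⟨χ, hχ, hχ1⟩ := exists_cutoff (d := d) hr hrR
  have hm : ∀ {v : Space d → ℂ} {η : Space d → ℂ}, IsTestFunction ⊤ (B d R) η → MemLp v 2 volume →
      MemLp (fun x => η x * v x) 2 volume := fun hη hv =>
    memLp_mul_of_hasCompactSupport hη.continuous hη.hasCompactSupport hv
  let N : (Space d → ℂ) → ℝ := fun a => (eLpNorm a 2 volume).toReal
  -- `a` and `b` collect the terms of `∫ χ u (ψ - Δψ) = ∫ a ψ + ∑ ∫ b_j ∂_j ψ`, found by expanding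
  -- `Δ(χψ)` and using the equation for `u`.
  let a : Space d → ℂ := fun x => χ x * u x + lap χ x * u x - χ x * g x
  have ha : MemLp a 2 volume := ((hm hχ hu).add (hm hχ.lap hu)).sub (hm hχ hg)
  let b : Fin d → Space d → ℂ := fun j x => 2 * (partialDeriv j χ x * u x)
  have hb : ∀ j, MemLp (b j) 2 volume := fun j => (hm (hχ.partialDeriv j) hu).const_mul 2
  have hdm : ∀ (f : 𝓢(Space d, ℂ)) (j : Fin d), MemLp (partialDeriv j f) 2 volume := fun f j =>
    (∂_{EuclideanSpace.single j (1 : ℝ)} f).memLp 2 volume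
  have hbound : ∀ f : 𝓢(Space d, ℂ), ‖∫ x, χ x * u x * partialDeriv i f x‖
      ≤ (N a + ∑ j, N (b j)) * ‖f.toLp 2 volume‖ := by
    intro f
    -- With `ψ = (1 - Δ)^{-1} ∂_i f`, both `ψ` and its first derivatives are bounded in `L²` by `f`
    -- itself, so the derivative on `f` costs nothing.
    obtain ⟨ψ, hψ⟩ := exists_sub_laplacian_eq (∂_{EuclideanSpace.single i (1 : ℝ)} f)
    have hψx : ∀ x, partialDeriv i f x = ψ x - lap ψ x := fun x => by
      rw [← lineDerivOp_single_apply, ← hψ, ← laplacian_schwartz_apply]; rfl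
    obtain ⟨hn0, hn1⟩ := norm_le_of_sub_laplacian_eq hψ
    have hχψ : IsTestFunction ⊤ (B d R) fun x => χ x * ψ x := hχ.mul_contDiff (ψ.smooth ⊤)
    have e : ∫ x, χ x * u x * partialDeriv i f x
        = (∫ x, a x * ψ x) + ∑ j, ∫ x, b j x * partialDeriv j ψ x := by
      have i1 := integrable_mul_of_memLp ha (ψ.memLp 2 volume)
      have i2 := fun j => integrable_mul_of_memLp (hb j) (hdm ψ j)
      have i3 := integrable_mul_of_memLp hg (hχψ.memLp volume)
      have i4 := integrable_mul_of_memLp hu (hχψ.lap.memLp volume)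
      have h0 := h _ hχψ
      rw [← integral_finsetSum _ fun j _ => i2 j, ← integral_add i1 (integrable_finsetSum _
        fun j _ => i2 j)]
      rw [← sub_eq_zero] at h0 ⊢
      have i5 : Integrable (fun x => a x * ψ x + ∑ j, b j x * partialDeriv j ψ x) :=
        i1.add (integrable_finsetSum _ fun j _ => i2 j)
      have i6 : Integrable fun x => χ x * u x * partialDeriv i f x :=
        (hm hχ hu).integrable_mul (hdm f i)
      rw [← integral_sub i4 i3] at h0
      rw [← integral_sub i6 i5, ← neg_eq_zero, ← integral_neg, ← h0]
      refine integral_congr_ae (ae_of_all _ fun x => ?_)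
      simp only [hψx, lap_mul hχ.contDiff (ψ.smooth ⊤) x, a, b, Finset.mul_sum]
      have : ∑ j, 2 * (partialDeriv j χ x * u x) * partialDeriv j ψ x
          = ∑ j, u x * (2 * (partialDeriv j χ x * partialDeriv j ψ x)) :=
        Finset.sum_congr rfl fun j _ => by ring
      rw [this, mul_add (u x), mul_add (u x), Finset.mul_sum]
      ring
    rw [e, add_mul, Finset.sum_mul]
    refine (norm_add_le _ _).trans (add_le_add ?_ ((norm_sum_le _ _).trans
      (Finset.sum_le_sum fun j _ => ?_)))
    · refine (norm_integral_mul_le ha (ψ.memLp 2 volume)).trans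
        (mul_le_mul_of_nonneg_left ?_ ENNReal.toReal_nonneg)
      rw [← SchwartzMap.norm_toLp]
      exact hn0
    · refine (norm_integral_mul_le (hb j) (hdm ψ j)).trans
        (mul_le_mul_of_nonneg_left ?_ ENNReal.toReal_nonneg)
      have e2 : ((∂_{EuclideanSpace.single j (1 : ℝ)} ψ : 𝓢(Space d, ℂ)) : Space d → ℂ)
          = partialDeriv j ψ := rfl
      rw [← e2, ← SchwartzMap.norm_toLp]
      exact hn1 j
  let l : 𝓢(Space d, ℂ) →ₗ[ℂ] ℂ :=
    (pairing ((hm hχ hu).toLp _)).toLinearMap ∘ₗ (SchwartzMap.toLpCLM ℂ ℂ 2 volume).toLinearMap ∘ₗ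
      (LineDeriv.lineDerivOpCLM ℂ 𝓢(Space d, ℂ) (EuclideanSpace.single i (1 : ℝ))).toLinearMap
  have hl : ∀ f, l f = ∫ x, χ x * u x * partialDeriv i f x := by
    intro f
    simp only [l, LinearMap.comp_apply, ContinuousLinearMap.coe_coe, SchwartzMap.toLpCLM_apply,
      LineDeriv.lineDerivOpCLM_apply]
    rw [pairing_comm, pairing_toLp]
    refine integral_congr_ae ?_
    filter_upwards [(hm hχ hu).coeFn_toLp] with x hx
    rw [hx, mul_comm, lineDerivOp_single_apply]
  obtain ⟨w, hw⟩ := exists_integral_mul_eq (SchwartzMap.toLpCLM ℂ ℂ 2 volume).toLinearMap l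
    (N a + ∑ j, N (b j)) fun f => by rw [hl]; exact hbound f
  refine ⟨w, fun φ hφ => ?_⟩
  let f : 𝓢(Space d, ℂ) := hφ.hasCompactSupport.toSchwartzMap hφ.contDiff
  have h1 := (hl f).symm.trans (hw f)
  have e1 : ∫ x, χ x * u x * partialDeriv i f x = ∫ x, u x * partialDeriv i φ x := by
    refine integral_congr_ae (ae_of_all _ fun x => ?_)
    change χ x * u x * partialDeriv i φ x = _
    by_cases hx : x ∈ tsupport φ
    · rw [hχ1 x (hφ.tsupport_subset hx), one_mul]
    · simp [notMem_tsupport_partialDeriv hx]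
  rw [← e1, h1]
  refine integral_congr_ae ?_
  filter_upwards [f.coeFn_toLp 2 volume] with x hx
  exact congrArg (w x * ·) hx

end Existence

/-! ### Weak solutions as pairs of a function and its gradient. -/

section WeakSolutions

variable {d : ℕ}

theorem ae_coord_eq_zero {Ω : Set (Space d)} (hΩ : IsOpen Ω) {g : Space d → ℂ}
    (hg : MemLp g 2 (volume.restrict Ω))
    (h : ∀ φ : Space d → ℂ, IsTestFunction ⊤ Ω φ → ∫ x in Ω, g x * φ x = 0) :
    ∀ᵐ x ∂volume.restrict Ω, g x = 0 := by
  rw [ae_restrict_iff' hΩ.measurableSet]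
  refine hΩ.ae_eq_zero_of_integral_contDiff_smul_eq_zero ?_ fun η h1 h2 h3 => ?_
  · exact (locallyIntegrableOn_of_locallyIntegrable_restrict
      (hg.locallyIntegrable one_le_two))
  · have ht : IsTestFunction ⊤ Ω fun x => (η x : ℂ) :=
      ⟨Complex.ofRealCLM.contDiff.comp h1, h2.comp_left (g := ((↑) : ℝ → ℂ)) rfl,
        (tsupport_comp_subset (g := ((↑) : ℝ → ℂ)) rfl η).trans h3⟩
    rw [← h _ ht, ← integral_indicator hΩ.measurableSet]
    refine integral_congr_ae (ae_of_all _ fun x => ?_)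
    by_cases hx : x ∈ Ω
    · simp [hx, mul_comm]
    · have : η x = 0 := image_eq_zero_of_notMem_tsupport fun h => hx (h3 h)
      simp [hx, this]

theorem IsWeakGradient.unique {Ω : Set (Space d)} (hΩ : IsOpen Ω) {u : L2 Ω} {G G' : L2Vec Ω}
    (h : IsWeakGradient Ω u G) (h' : IsWeakGradient Ω u G') : G = G' := by
  have hi : ∀ i, ∀ᵐ x ∂volume.restrict Ω, G x i - G' x i = 0 := fun i => by
    refine ae_coord_eq_zero hΩ ((memLp_coord G i).sub (memLp_coord G' i)) fun φ hφ => ?_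
    have hφm : MemLp φ 2 (volume.restrict Ω) := (hφ.memLp volume).restrict Ω
    have e := (h φ hφ i).symm.trans (h' φ hφ i)
    rw [neg_inj, ← sub_eq_zero, ← integral_sub (integrable_mul_of_memLp (memLp_coord G i) hφm)
      (integrable_mul_of_memLp (memLp_coord G' i) hφm)] at e
    rw [← e]
    refine integral_congr_ae (ae_of_all _ fun x => ?_)
    ring
  refine Lp.ext ?_
  filter_upwards [ae_all_iff.2 hi] with x hx
  ext i
  exact sub_eq_zero.1 (hx i)

/-- Uniqueness makes the chosen `weakGradient` independent of the choice. -/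
theorem weakGradient_eq {R : ℝ} {u : L2 (B d R)} {G : L2Vec (B d R)}
    (h : IsWeakGradient (B d R) u G) : weakGradient (⟨u, G, h⟩ : H1 (B d R)) = G :=
  IsWeakGradient.unique isOpen_ball (weakGradient_spec _) h

/-- `(u, G)` satisfies the weak form of `div G + V u = f`, tested with smooth functions. -/
def IsWeakPair (V f : Space d → ℂ) (R : ℝ) (u : L2 (B d R)) (G : L2Vec (B d R)) : Prop :=
  ∀ φ : Space d → ℂ, IsTestFunction ⊤ (B d R) φ →
    (∫ x in B d R, (V x * u x - f x) * φ x) + ∑ i, ∫ x in B d R, -G x i * partialDeriv i φ x = 0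

/-- Extending `f` by zero and solving on the ball of radius `R + 1` makes all of `B_R` interior, so
the regularity result reaches it entirely. -/
theorem exists_isWeakPair {R : ℝ} (hR : 0 < R) (i0 : Fin d) {V f : Space d → ℂ} {M : ℝ}
    (hM0 : 0 ≤ M) (hV : AEStronglyMeasurable V volume) (hM : ∀ᵐ x, ‖V x‖ ≤ M)
    (hf : MemLp f 2 (volume.restrict (B d R))) :
    ∃ (u : L2 (B d R)) (G : L2Vec (B d R)), IsWeakGradient (B d R) u G ∧ IsWeakPair V f R u G := by
  have hf' : MemLp ((B d R).indicator f) 2 volume :=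
    (memLp_indicator_iff_restrict measurableSet_ball).2 hf
  obtain ⟨w, hw⟩ := exists_distributional_solution (R := R + 1) (by linarith) i0 hM0 hV hM hf'
  have hVw := memLp_mul_of_ae_bound hV hM (Lp.memLp w)
  have hlap : ∀ φ : Space d → ℂ, IsTestFunction ⊤ (B d (R + 1)) φ →
      ∫ x, w x * lap φ x = ∫ x, ((B d R).indicator f x - V x * w x) * φ x := by
    intro φ hφ
    have h1 := hw φ hφ
    have i1 := integrable_mul_of_memLp (Lp.memLp w) (hφ.lap.memLp volume)
    have i2 := integrable_mul_of_memLp hVw (hφ.memLp volume)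
    have i3 := integrable_mul_of_memLp hf' (hφ.memLp volume)
    have e1 : ∫ x, w x * (lap φ x + V x * φ x)
        = (∫ x, w x * lap φ x) + ∫ x, V x * w x * φ x := by
      rw [← integral_add i1 i2]
      refine integral_congr_ae (ae_of_all _ fun x => ?_)
      ring
    have e2 : ∫ x, ((B d R).indicator f x - V x * w x) * φ x
        = (∫ x, (B d R).indicator f x * φ x) - ∫ x, V x * w x * φ x := by
      rw [← integral_sub i3 i2]
      refine integral_congr_ae (ae_of_all _ fun x => ?_)
      ring
    rw [e2, ← h1, e1]
    ring
  choose g hg using fun i => exists_weak_partialDeriv hR (lt_add_one R) (Lp.memLp w)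
    (hf'.sub hVw) hlap i
  have hset : ∀ {p q : Space d → ℂ}, IsTestFunction ⊤ (B d R) q →
      ∫ x in B d R, p x * q x = ∫ x, p x * q x := by
    intro p q hq
    refine setIntegral_eq_integral_of_forall_compl_eq_zero fun x hx => ?_
    rw [image_eq_zero_of_notMem_tsupport fun h => hx (hq.tsupport_subset h), mul_zero]
  have hum : MemLp w 2 (volume.restrict (B d R)) := (Lp.memLp w).restrict _
  -- `g i` satisfies `∫ w ∂_i φ = ∫ g_i φ`, so the gradient is `-g`.
  have hGm : MemLp (fun x => (WithLp.toLp 2 fun i => -g i x : CVec d)) 2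
      (volume.restrict (B d R)) :=
    MemLp.of_eval_piLp fun i => ((Lp.memLp (g i)).restrict _).neg
  have hu : ∀ q : Space d → ℂ, ∫ x in B d R, hum.toLp _ x * q x = ∫ x in B d R, w x * q x := by
    intro q
    refine integral_congr_ae ?_
    filter_upwards [hum.coeFn_toLp] with x hx
    rw [hx]
  have hG : ∀ (q : Space d → ℂ) (i : Fin d),
      ∫ x in B d R, hGm.toLp _ x i * q x = -∫ x in B d R, g i x * q x := by
    intro q i
    rw [← integral_neg]
    refine integral_congr_ae ?_
    filter_upwards [hGm.coeFn_toLp] with x hx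
    rw [hx, neg_mul]
  refine ⟨hum.toLp _, hGm.toLp _, fun φ hφ i => ?_, fun φ hφ => ?_⟩
  · rw [hu, hG, neg_neg, hset (hφ.partialDeriv i), hset hφ]
    exact hg i φ hφ
  · have hφ' : IsTestFunction ⊤ (B d (R + 1)) φ := hφ.mono (ball_subset_ball (by linarith))
    -- The defining identity of the gradient, tested with `∂_i φ`, recovers the distributional
    -- Laplacian.
    have e1 : ∑ i, ∫ x in B d R, -hGm.toLp _ x i * partialDeriv i φ x = ∫ x, w x * lap φ x := by
      simp only [lap, Finset.mul_sum]
      rw [integral_finsetSum _ fun i _ => integrable_mul_of_memLp (Lp.memLp w)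
        (((hφ.partialDeriv i).partialDeriv i).memLp volume)]
      refine Finset.sum_congr rfl fun i _ => ?_
      simp only [neg_mul]
      rw [integral_neg, hG, neg_neg, hset (hφ.partialDeriv i)]
      exact (hg i _ (hφ.partialDeriv i)).symm
    rw [e1, hlap φ hφ', ← hset hφ, ← integral_add]
    · rw [← integral_zero (Space d) ℂ (μ := volume.restrict (B d R))]
      refine integral_congr_ae ?_
      filter_upwards [hum.coeFn_toLp, ae_restrict_mem measurableSet_ball] with x hx hxB
      rw [hx, Set.indicator_of_mem hxB]
      ring
    · refine integrable_mul_of_memLp (MemLp.sub ?_ hf) ((hφ.memLp volume).restrict _)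
      exact memLp_mul_of_ae_bound hV.restrict (ae_restrict_of_ae hM) (Lp.memLp _)
    · exact integrable_mul_of_memLp ((hf'.sub hVw).restrict _) ((hφ.memLp volume).restrict _)

/-- On weakly differentiable functions, testing with smooth functions is the same as testing with
conjugates of functions of class `C¹`. -/
theorem isWeakSolution_iff {k R M : ℝ} (hR : 0 < R) {n : Space d → ℝ} {f : Space d → ℂ}
    (hn : AEStronglyMeasurable n volume) (hM : ∀ᵐ x, ‖n x‖ ≤ M)
    (hf : MemLp f 2 (volume.restrict (B d R))) (u : H1 (B d R)) :
    IsWeakSolution k n f R u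
      ↔ IsWeakPair (fun x => (k : ℂ) ^ 2 * (n x : ℂ) ^ 2) f R u.1 (weakGradient u) := by
  have hnu : MemLp (fun x => (n x : ℂ) ^ 2 * u.1 x) 2 (volume.restrict (B d R)) := by
    refine memLp_mul_of_ae_bound (M := M ^ 2)
      ((Complex.continuous_ofReal.comp_aestronglyMeasurable hn).pow 2).restrict
      (ae_restrict_of_ae ?_) (Lp.memLp _)
    filter_upwards [hM] with x hx
    rw [norm_pow, Complex.norm_real]
    exact pow_le_pow_left₀ (norm_nonneg _) hx 2
  have hVu : MemLp (fun x => (k : ℂ) ^ 2 * (n x : ℂ) ^ 2 * u.1 x) 2 (volume.restrict (B d R)) := by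
    simpa only [mul_assoc] using hnu.const_mul ((k : ℂ) ^ 2)
  have hGm := fun i => memLp_coord (weakGradient u) i
  have key : ∀ φ : Space d → ℂ, IsTestFunction 1 (B d R) φ →
      ((∫ x in B d R, ((k : ℂ) ^ 2 * (n x : ℂ) ^ 2 * u.1 x - f x) * φ x)
        + ∑ i, ∫ x in B d R, -weakGradient u x i * partialDeriv i φ x
      = -(∫ x in B d R, ∑ i, weakGradient u x i * partialDeriv i φ x)
        + (k : ℂ) ^ 2 * (∫ x in B d R, (n x : ℂ) ^ 2 * u.val x * φ x)
        - ∫ x in B d R, f x * φ x) := by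
    intro φ hφ
    have hφm := (hφ.memLp volume).restrict (B d R)
    have hdm := fun i => (hφ.memLp_partialDeriv i volume).restrict (B d R)
    rw [integral_finsetSum _ fun i _ => integrable_mul_of_memLp (hGm i) (hdm i),
      ← integral_const_mul]
    simp only [neg_mul, integral_neg, Finset.sum_neg_distrib]
    have e : ∫ x in B d R, ((k : ℂ) ^ 2 * (n x : ℂ) ^ 2 * u.1 x - f x) * φ x
        = (∫ x in B d R, (k : ℂ) ^ 2 * ((n x : ℂ) ^ 2 * u.1 x * φ x))
          - ∫ x in B d R, f x * φ x := by
      rw [← integral_sub]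
      · refine integral_congr_ae (ae_of_all _ fun x => ?_)
        ring
      · exact (integrable_mul_of_memLp hnu hφm).const_mul _
      · exact integrable_mul_of_memLp hf hφm
    rw [e]
    ring
  have hconj : ∀ φ : Space d → ℂ, IsTestFunction 1 (B d R) φ → ∀ i x,
      partialDeriv i (fun x => conj (φ x)) x = conj (partialDeriv i φ x) := fun φ hφ i x =>
    partialDeriv_conj (hφ.contDiff.differentiable (by simp) x) i
  constructor
  · intro h φ hφ
    rw [key φ hφ.of_top, sub_eq_zero]
    have hc := h _ hφ.of_top.conj
    have hcc := hconj _ hφ.of_top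
    simpa only [hcc, Complex.conj_conj] using hc
  · intro h φ hφ
    have h1 := integral_add_sum_eq_zero_of_contDiff_one hR (hVu.sub hf)
      (fun i => (hGm i).neg) h hφ.conj
    have h2 := (key _ hφ.conj).symm.trans h1
    rw [sub_eq_zero] at h2
    simpa only [hconj φ hφ] using h2

end WeakSolutions

/-! ### Vanishing flux and coercivity. -/

section Coercivity

variable {d : ℕ}

/-- A smooth approximation of the positive part. -/
def smoothPosPart (δ t : ℝ) : ℝ := ∫ s in (0 : ℝ)..t, Real.smoothTransition (s / δ)

theorem hasDerivAt_smoothPosPart (δ t : ℝ) :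
    HasDerivAt (smoothPosPart δ) (Real.smoothTransition (t / δ)) t := by
  have hc : Continuous fun s : ℝ => Real.smoothTransition (s / δ) :=
    Real.smoothTransition.continuous.comp (continuous_id.div_const δ)
  exact intervalIntegral.integral_hasDerivAt_right (hc.intervalIntegrable _ _)
    (hc.stronglyMeasurableAtFilter _ _) hc.continuousAt

theorem contDiff_smoothPosPart (δ : ℝ) :
    ContDiff ℝ ((⊤ : ℕ∞) : WithTop ℕ∞) (smoothPosPart δ) := by
  rw [contDiff_infty_iff_deriv]
  refine ⟨fun t => (hasDerivAt_smoothPosPart δ t).differentiableAt, ?_⟩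
  rw [funext fun t => (hasDerivAt_smoothPosPart δ t).deriv]
  exact Real.smoothTransition.contDiff.comp (contDiff_id.div_const δ)

theorem smoothPosPart_of_nonpos {δ t : ℝ} (hδ : 0 < δ) (ht : t ≤ 0) : smoothPosPart δ t = 0 := by
  rw [smoothPosPart, intervalIntegral.integral_symm, neg_eq_zero]
  refine (intervalIntegral.integral_congr (g := fun _ => (0 : ℝ)) fun s hs => ?_).trans (by simp)
  rw [Set.uIcc_of_le ht] at hs
  exact Real.smoothTransition.zero_of_nonpos (div_nonpos_of_nonpos_of_nonneg hs.2 hδ.le)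

/-- A smooth compactly supported approximation of `x ↦ (R - |x|)₊`. -/
def coneApprox (R δ : ℝ) (x : Space d) : ℝ :=
  smoothPosPart δ (R - δ - Real.sqrt (‖x‖ ^ 2 + δ ^ 2))

/-- The square root smooths the norm at the origin, and the shift by `δ` keeps the support in the
closed ball of radius `R - δ`. -/
theorem isTestFunction_coneApprox {R δ : ℝ} (hδ : 0 < δ) :
    IsTestFunction ⊤ (B d R) fun x => (coneApprox R δ x : ℂ) := by
  have hsmooth : ContDiff ℝ ((⊤ : ℕ∞) : WithTop ℕ∞) (coneApprox (d := d) R δ) := by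
    refine (contDiff_smoothPosPart δ).comp (contDiff_const.sub ?_)
    refine ((contDiff_norm_sq ℝ).add contDiff_const).sqrt fun x => ?_
    positivity
  have hsupp : tsupport (fun x : Space d => (coneApprox R δ x : ℂ)) ⊆ closedBall 0 (R - δ) := by
    refine closure_minimal (fun x hx => ?_) isClosed_closedBall
    rw [mem_closedBall_zero_iff]
    by_contra hlt
    rw [not_le] at hlt
    refine hx ?_
    have : ‖x‖ ≤ Real.sqrt (‖x‖ ^ 2 + δ ^ 2) := Real.le_sqrt_of_sq_le (by nlinarith)
    simp only [coneApprox]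
    rw [smoothPosPart_of_nonpos hδ (by linarith), Complex.ofReal_zero]
  refine ⟨Complex.ofRealCLM.contDiff.comp hsmooth, ?_,
    hsupp.trans (closedBall_subset_ball (by linarith))⟩
  exact (isCompact_closedBall (0 : Space d) (R - δ)).of_isClosed_subset (isClosed_tsupport _) hsupp

theorem partialDeriv_coneApprox {R δ : ℝ} (hδ : 0 < δ) (i : Fin d) (x : Space d) :
    partialDeriv i (fun x => (coneApprox R δ x : ℂ)) x
      = ((-(Real.smoothTransition ((R - δ - Real.sqrt (‖x‖ ^ 2 + δ ^ 2)) / δ)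
          * (x i / Real.sqrt (‖x‖ ^ 2 + δ ^ 2))) : ℝ) : ℂ) := by
  have h1 : HasFDerivAt (fun x : Space d => ‖x‖ ^ 2 + δ ^ 2) (2 • innerSL ℝ x) x :=
    ((hasStrictFDerivAt_norm_sq x).hasFDerivAt).add_const _
  have h2 := (h1.sqrt (by positivity)).const_sub (R - δ)
  have h3 := (hasDerivAt_smoothPosPart δ (R - δ - Real.sqrt (‖x‖ ^ 2 + δ ^ 2))).comp_hasFDerivAt x h2
  have h4 := Complex.ofRealCLM.hasFDerivAt.comp x h3
  have h5 : partialDeriv i (fun x => (coneApprox R δ x : ℂ)) x = _ :=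
    congrArg (fun L : Space d →L[ℝ] ℂ => L (EuclideanSpace.single i (1 : ℝ))) h4.fderiv
  rw [h5]
  simp [EuclideanSpace.inner_single_right]
  left
  ring

theorem abs_coord_div_sqrt_le {δ : ℝ} (i : Fin d) (x : Space d) :
    |x i / Real.sqrt (‖x‖ ^ 2 + δ ^ 2)| ≤ 1 := by
  rw [abs_div, abs_of_nonneg (Real.sqrt_nonneg _)]
  refine div_le_one_of_le₀ ?_ (Real.sqrt_nonneg _)
  exact (PiLp.norm_apply_le x i).trans (Real.le_sqrt_of_sq_le (by nlinarith))

theorem norm_partialDeriv_coneApprox_le {R δ : ℝ} (hδ : 0 < δ) (i : Fin d) (x : Space d) :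
    ‖partialDeriv i (fun x => (coneApprox R δ x : ℂ)) x‖ ≤ 1 := by
  rw [partialDeriv_coneApprox hδ, Complex.norm_real, norm_neg, norm_mul]
  refine mul_le_one₀ ?_ (norm_nonneg _) (abs_coord_div_sqrt_le i x)
  rw [Real.norm_of_nonneg (Real.smoothTransition.nonneg _)]
  exact Real.smoothTransition.le_one _

open Filter Topology in
theorem tendsto_partialDeriv_coneApprox {R : ℝ} {x : Space d} (hx : x ∈ B d R) (i : Fin d)
    {δ : ℕ → ℝ} (hδ : ∀ m, 0 < δ m) (hδ0 : Tendsto δ atTop (𝓝 0)) :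
    Tendsto (fun m => partialDeriv i (fun x => (coneApprox R (δ m) x : ℂ)) x) atTop
      (𝓝 (-(x i / ‖x‖ : ℝ) : ℂ)) := by
  rcases eq_or_ne x 0 with rfl | hx0
  -- At the origin both sides are `0`, since `0 / 0 = 0`.
  · simp [partialDeriv_coneApprox (hδ _)]
  simp only [fun m => partialDeriv_coneApprox (R := R) (hδ m) i x, ← Complex.ofReal_neg]
  refine (Complex.continuous_ofReal.tendsto _).comp ?_
  have hs : Tendsto (fun m => Real.sqrt (‖x‖ ^ 2 + δ m ^ 2)) atTop (𝓝 ‖x‖) := by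
    have := ((hδ0.pow 2).const_add (‖x‖ ^ 2)).sqrt
    simpa using this
  have hone : ∀ᶠ m in atTop,
      Real.smoothTransition ((R - δ m - Real.sqrt (‖x‖ ^ 2 + δ m ^ 2)) / δ m) = 1 := by
    have h1 : Tendsto (fun m => R - δ m - Real.sqrt (‖x‖ ^ 2 + δ m ^ 2) - δ m) atTop
        (𝓝 (R - 0 - ‖x‖ - 0)) := ((hδ0.const_sub R).sub hs).sub hδ0
    have h2 : (0 : ℝ) < R - 0 - ‖x‖ - 0 := by
      have := mem_ball_zero_iff.1 hx
      linarith
    filter_upwards [h1.eventually_const_lt h2] with m hm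
    refine Real.smoothTransition.one_of_one_le ?_
    rw [one_le_div (hδ m)]
    linarith
  have h3 : Tendsto (fun m => -(1 * (x i / Real.sqrt (‖x‖ ^ 2 + δ m ^ 2)))) atTop
      (𝓝 (-(1 * (x i / ‖x‖)))) :=
    ((tendsto_const_nhds.div hs (norm_ne_zero_iff.2 hx0)).const_mul 1).neg
  rw [one_mul] at h3
  refine h3.congr' ?_
  filter_upwards [hone] with m hm
  rw [hm]

theorem im_integral_eq_zero {X : Type*} [MeasurableSpace X] {μ : Measure X} {g : X → ℂ}
    (h : ∀ x, (g x).im = 0) : (∫ x, g x ∂μ).im = 0 := by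
  have : g = fun x => (((g x).re : ℝ) : ℂ) := by
    ext x
    exact Complex.ext rfl (by simp [h x])
  have h2 : ∫ x, g x ∂μ = ∫ x, (((g x).re : ℝ) : ℂ) ∂μ :=
    integral_congr_ae (ae_of_all _ fun x => congrFun this x)
  rw [h2, integral_complex_ofReal, Complex.ofReal_im]

variable {R M : ℝ} {V : Space d → ℝ} {u : L2 (B d R)} {G : L2Vec (B d R)}

/-- The conjugated equation is tested with `η u`. As `V` and `η` are real, the terms `V η |u|²` and
`η |G|²` are real, so the flux term containing `∂η` must be real as well. -/
theorem im_sum_integral_partialDeriv_eq_zero (hR : 0 < R) (hV : AEStronglyMeasurable V volume)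
    (hM : ∀ᵐ x, ‖V x‖ ≤ M) (hG : IsWeakGradient (B d R) u G)
    (hu : IsWeakPair (fun x => (V x : ℂ)) 0 R u G) {η : Space d → ℝ}
    (hη : IsTestFunction ⊤ (B d R) fun x => (η x : ℂ)) :
    (∑ i, ∫ x in B d R, conj (G x i) * u x * partialDeriv i (fun x => (η x : ℂ)) x).im = 0 := by
  have hVu : MemLp (fun x => (V x : ℂ) * u x) 2 (volume.restrict (B d R)) := by
    refine memLp_mul_of_ae_bound (M := M)
      (Complex.continuous_ofReal.comp_aestronglyMeasurable hV).restrict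
      (ae_restrict_of_ae ?_) (Lp.memLp _)
    filter_upwards [hM] with x hx
    rwa [Complex.norm_real]
  have hGc : ∀ i, MemLp (fun x => -conj (G x i)) 2 (volume.restrict (B d R)) := fun i =>
    (memLp_coord G i).star.neg
  have key := integral_add_sum_eq_zero_of_isWeakGradient hR hVu.star hGc
    (fun φ hφ => by
      have h := congrArg conj (hu _ hφ.conj)
      rw [map_add, map_sum, map_zero, ← integral_conj] at h
      rw [← h]
      congr 1
      · refine integral_congr_ae (ae_of_all _ fun x => ?_)
        simp
      · refine Finset.sum_congr rfl fun i _ => ?_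
        rw [← integral_conj]
        refine integral_congr_ae (ae_of_all _ fun x => ?_)
        simp [partialDeriv_conj (hφ.contDiff.differentiable (by simp) x)]) hG hη
  have hηG : ∀ i, MemLp (fun x => (η x : ℂ) * G x i) 2 (volume.restrict (B d R)) := fun i =>
    memLp_mul_of_hasCompactSupport hη.continuous hη.hasCompactSupport (memLp_coord G i)
  have hdηu : ∀ i, MemLp (fun x => partialDeriv i (fun x => (η x : ℂ)) x * u x) 2
      (volume.restrict (B d R)) := fun i =>
    memLp_mul_of_hasCompactSupport (hη.partialDeriv i).continuous
      (hη.partialDeriv i).hasCompactSupport (Lp.memLp u)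
  have hsplit : ∀ i, ∫ x in B d R, -conj (G x i)
        * ((η x : ℂ) * G x i + partialDeriv i (fun x => (η x : ℂ)) x * u x)
      = (∫ x in B d R, -conj (G x i) * ((η x : ℂ) * G x i))
        - ∫ x in B d R, conj (G x i) * u x * partialDeriv i (fun x => (η x : ℂ)) x := by
    intro i
    rw [sub_eq_add_neg, ← integral_neg, ← integral_add]
    · refine integral_congr_ae (ae_of_all _ fun x => ?_)
      ring
    · exact integrable_mul_of_memLp (hGc i) (hηG i)
    · refine (integrable_mul_of_memLp (hGc i) (hdηu i)).congr (ae_of_all _ fun x => ?_)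
      ring
  simp only [hsplit, Finset.sum_sub_distrib] at key
  have h1 := im_integral_eq_zero (μ := volume.restrict (B d R))
    (g := fun x => star (fun x => (V x : ℂ) * u x) x * ((η x : ℂ) * u x)) fun x => by
      simp
      ring
  have h2 : ∀ i, (∫ x in B d R, -conj (G x i) * ((η x : ℂ) * G x i)).im = 0 := fun i =>
    im_integral_eq_zero fun x => by
      simp
      ring
  have h3 := congrArg Complex.im key
  rw [Complex.add_im, Complex.sub_im, h1, Complex.im_sum, Finset.sum_eq_zero fun i _ => h2 i] at h3
  simpa using h3

theorem norm_radialUnit {x : Space d} (hx : x ≠ 0) : ‖radialUnit x‖ = 1 := by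
  have hx' := norm_ne_zero_iff.2 hx
  rw [← sq_eq_sq₀ (norm_nonneg _) zero_le_one, EuclideanSpace.norm_sq_eq]
  simp only [radialUnit, Complex.norm_real, norm_div, norm_norm, div_pow, ← Finset.sum_div]
  rw [← EuclideanSpace.norm_sq_eq, div_self (pow_ne_zero 2 hx'), one_pow]

theorem norm_radialUnit_le (x : Space d) : ‖radialUnit x‖ ≤ 1 := by
  rcases eq_or_ne x 0 with rfl | hx
  · have : radialUnit (0 : Space d) = 0 := by
      ext i
      simp [radialUnit]
    simp [this]
  · exact (norm_radialUnit hx).le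

open Filter Topology in
-- Letting `η` tend to `(R - |x|)₊`, whose gradient is `-x/|x|`, integrates the zero flux through
-- the spheres `∂B_r` over `r < R`, with no need of traces. The derivatives of `η` are bounded by
-- `1`, so dominated convergence applies.
theorem im_integral_inner_radialUnit_eq_zero (hR : 0 < R) (hV : AEStronglyMeasurable V volume)
    (hM : ∀ᵐ x, ‖V x‖ ≤ M) (hG : IsWeakGradient (B d R) u G)
    (hu : IsWeakPair (fun x => (V x : ℂ)) 0 R u G) :
    (∫ x in B d R, inner ℂ (G x) (radialUnit x) * u x).im = 0 := by
  have hGu : ∀ i, Integrable (fun x => conj (G x i) * u x) (volume.restrict (B d R)) := fun i =>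
    integrable_mul_of_memLp (memLp_coord G i).star (Lp.memLp u)
  let δ : ℕ → ℝ := fun m => 1 / ((m : ℝ) + 1)
  have hδ : ∀ m, 0 < δ m := fun m => by positivity
  have hlim : ∀ i, Tendsto (fun m => ∫ x in B d R, conj (G x i) * u x
      * partialDeriv i (fun x => (coneApprox R (δ m) x : ℂ)) x) atTop
      (𝓝 (∫ x in B d R, conj (G x i) * u x * (-(x i / ‖x‖ : ℝ) : ℂ))) := by
    intro i
    refine tendsto_integral_of_dominated_convergence (fun x => ‖conj (G x i) * u x‖)
      (fun m => ?_) (hGu i).norm (fun m => ae_of_all _ fun x => ?_) ?_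
    · exact (hGu i).1.mul
        ((isTestFunction_coneApprox (hδ m)).partialDeriv i).continuous.aestronglyMeasurable
    · rw [norm_mul]
      exact mul_le_of_le_one_right (norm_nonneg _) (norm_partialDeriv_coneApprox_le (hδ m) i x)
    · filter_upwards [ae_restrict_mem measurableSet_ball] with x hx
      exact (tendsto_partialDeriv_coneApprox hx i hδ
        tendsto_one_div_add_atTop_nhds_zero_nat).const_mul _
  have hsum := (Complex.continuous_im.tendsto _).comp (tendsto_finsetSum Finset.univ
    fun i _ => hlim i)
  have hzero : ∀ m, (∑ i, ∫ x in B d R, conj (G x i) * u x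
      * partialDeriv i (fun x => (coneApprox R (δ m) x : ℂ)) x).im = 0 := fun m =>
    im_sum_integral_partialDeriv_eq_zero hR hV hM hG hu (isTestFunction_coneApprox (hδ m))
  have h0 := tendsto_nhds_unique hsum ((tendsto_const_nhds (x := (0 : ℝ))).congr
    fun m => (hzero m).symm)
  have hmeas : ∀ i : Fin d, Measurable fun x : Space d => (-(x i / ‖x‖ : ℝ) : ℂ) := fun i =>
    (Complex.measurable_ofReal.comp (((EuclideanSpace.proj i : Space d →L[ℝ] ℝ).measurable).div
      measurable_norm)).neg
  rw [← integral_finsetSum] at h0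
  · rw [← neg_eq_zero, ← Complex.neg_im, ← integral_neg, ← h0]
    congr 1
    refine integral_congr_ae (ae_of_all _ fun x => ?_)
    simp only [PiLp.inner_apply, RCLike.inner_apply, radialUnit, Finset.sum_mul,
      ← Finset.sum_neg_distrib]
    refine Finset.sum_congr rfl fun i _ => ?_
    ring
  · intro i _
    refine (hGu i).mul_bdd (c := 1) (hmeas i).aestronglyMeasurable (ae_of_all _ fun x => ?_)
    rw [norm_neg, Complex.norm_real, norm_div, norm_norm]
    exact div_le_one_of_le₀ (PiLp.norm_apply_le x i) (norm_nonneg _)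

theorem measurable_radialUnit : Measurable (radialUnit (d := d)) :=
  (WithLp.measurable_toLp 2 _).comp (measurable_pi_lambda _ fun i =>
    Complex.measurable_ofReal.comp (((EuclideanSpace.proj i : Space d →L[ℝ] ℝ).measurable).div
      measurable_norm))

theorem integral_norm_sq_eq {X E : Type*} [MeasurableSpace X] {μ : Measure X}
    [NormedAddCommGroup E] [InnerProductSpace ℂ E] (v : Lp E 2 μ) :
    ∫ x, ‖v x‖ ^ 2 ∂μ = ‖v‖ ^ 2 := by
  have h := inner_self_eq_norm_sq_to_K (𝕜 := ℂ) v
  rw [L2.inner_def] at h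
  simp only [inner_self_eq_norm_sq_to_K] at h
  have h2 : ∫ x, ((‖v x‖ ^ 2 : ℝ) : ℂ) ∂μ = ((‖v‖ ^ 2 : ℝ) : ℂ) := by
    push_cast
    exact h
  rw [integral_complex_ofReal] at h2
  exact_mod_cast h2

/-- For homogeneous solutions the radiation seminorm controls the `L²` norm. -/
theorem mul_norm_le_of_radiation (hd : 1 ≤ d) {k nstar C : ℝ} {n : Space d → ℝ} (hR : 0 < R)
    (hk : 0 < k) (hn : AEStronglyMeasurable n volume) (hM : ∀ᵐ x, ‖n x‖ ≤ M) (hC : 0 ≤ C)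
    (hnstar : ∀ x, nstar ≤ n x) (hG : IsWeakGradient (B d R) u G)
    (hu : IsWeakPair (fun x => (k : ℂ) ^ 2 * (n x : ℂ) ^ 2) 0 R u G) (H : L2Vec (B d R))
    (hH : ∀ᵐ x ∂volume.restrict (B d R),
      ‖G x - (Complex.I * k * n x * u x) • radialUnit x‖ ≤ C * ‖H x‖) :
    k * nstar * ‖u‖ ≤ C * ‖H‖ := by
  have hnc : AEStronglyMeasurable (fun x => (n x : ℂ)) (volume.restrict (B d R)) :=
    (Complex.continuous_ofReal.comp_aestronglyMeasurable hn).restrict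
  have him := im_integral_inner_radialUnit_eq_zero (V := fun x => k ^ 2 * n x ^ 2)
    (M := k ^ 2 * M ^ 2) hR ((hn.pow 2).const_mul _) (by
      filter_upwards [hM] with x hx
      rw [norm_mul, norm_pow, norm_pow, Real.norm_of_nonneg hk.le]
      gcongr) hG (by
      have e : (fun x => ((k ^ 2 * n x ^ 2 : ℝ) : ℂ)) = fun x => (k : ℂ) ^ 2 * (n x : ℂ) ^ 2 := by
        ext x
        push_cast
        rfl
      rw [e]
      exact hu)
  let s : Space d → ℂ := fun x =>
    inner ℂ (G x - (Complex.I * k * n x * u x) • radialUnit x) (radialUnit x)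
  have hsH : ∀ᵐ x ∂volume.restrict (B d R), ‖s x‖ ≤ C * ‖H x‖ := by
    filter_upwards [hH] with x hx
    refine (norm_inner_le_norm _ _).trans ((mul_le_of_le_one_right (norm_nonneg _)
      (norm_radialUnit_le x)).trans hx)
  have hrm : AEStronglyMeasurable (radialUnit (d := d)) (volume.restrict (B d R)) :=
    measurable_radialUnit.aestronglyMeasurable
  have hsm : AEStronglyMeasurable s (volume.restrict (B d R)) :=
    ((Lp.aestronglyMeasurable G).sub (((hnc.const_mul _).mul (Lp.aestronglyMeasurable u)).smul
      hrm)).inner hrm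
  have hs : MemLp s 2 (volume.restrict (B d R)) := (Lp.memLp H).of_le_mul hsm hsH
  have hnu : Integrable (fun x => k * n x * ‖u x‖ ^ 2) (volume.restrict (B d R)) := by
    have h1 : MemLp (fun x => (n x : ℂ) * u x) 2 (volume.restrict (B d R)) := by
      refine memLp_mul_of_ae_bound (M := M) hnc (ae_restrict_of_ae ?_) (Lp.memLp u)
      filter_upwards [hM] with x hx
      rwa [Complex.norm_real]
    have h2 := ((integrable_mul_of_memLp h1 (Lp.memLp u).star).re).const_mul k
    refine h2.congr (ae_of_all _ fun x => ?_)
    have : ((n x : ℂ) * u x * star (u x)).re = n x * ‖u x‖ ^ 2 := by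
      rw [mul_assoc, RCLike.star_def, Complex.mul_conj, ← Complex.ofReal_mul, Complex.ofReal_re,
        Complex.normSq_eq_norm_sq]
    simp only [RCLike.re_to_complex, Pi.star_apply, this]
    ring
  -- Conjugation in the first slot turns `i k n u` into `-i k n ū`. With `|x/|x|| = 1` off the
  -- origin, the imaginary part then yields `∫ k n |u|² = Im ∫ s u`.
  have hsplit : ∫ x in B d R, inner ℂ (G x) (radialUnit x) * u x
      = (∫ x in B d R, s x * u x)
        - Complex.I * ((∫ x in B d R, k * n x * ‖u x‖ ^ 2 : ℝ) : ℂ) := by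
    rw [← integral_complex_ofReal, ← integral_const_mul, ← integral_sub]
    · have : Nonempty (Fin d) := ⟨⟨0, hd⟩⟩
      have hne : ∀ᵐ x ∂volume.restrict (B d R), x ≠ (0 : Space d) :=
        ae_restrict_of_ae (Measure.ae_ne volume 0)
      refine integral_congr_ae ?_
      filter_upwards [hne] with x hx
      have hr : inner ℂ (radialUnit x) (radialUnit x) = 1 := by
        rw [inner_self_eq_norm_sq_to_K, norm_radialUnit hx]
        simp
      simp only [s]
      rw [inner_sub_left, inner_smul_left, hr]
      have h3 : conj (u x) * u x = ((‖u x‖ ^ 2 : ℝ) : ℂ) := by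
        rw [mul_comm, Complex.mul_conj, Complex.normSq_eq_norm_sq]
      simp only [map_mul, Complex.conj_I, Complex.conj_ofReal]
      rw [Complex.ofReal_mul, ← h3]
      push_cast
      ring
    · exact integrable_mul_of_memLp hs (Lp.memLp u)
    · exact (hnu.ofReal).const_mul _
  rw [hsplit, Complex.sub_im, sub_eq_zero] at him
  simp only [Complex.mul_im, Complex.I_re, Complex.I_im, Complex.ofReal_re, Complex.ofReal_im,
    zero_mul, one_mul, zero_add] at him
  have h1 : k * nstar * ‖u‖ ^ 2 ≤ ∫ x in B d R, k * n x * ‖u x‖ ^ 2 := by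
    rw [← integral_norm_sq_eq u, ← integral_const_mul]
    refine integral_mono ?_ hnu fun x => ?_
    · exact ((Lp.memLp u).norm.integrable_sq).const_mul _
    · have := hnstar x
      dsimp only
      gcongr
  have h2 := Complex.abs_im_le_norm (∫ x in B d R, s x * u x)
  have h3 := norm_integral_mul_le hs (Lp.memLp u)
  have h4 := toReal_eLpNorm_le_mul (Lp.memLp H) hC hsH
  rw [← Lp.norm_def] at h3 h4
  have h5 : k * nstar * ‖u‖ ^ 2 ≤ C * ‖H‖ * ‖u‖ :=
    calc _ ≤ _ := h1
      _ = (∫ x in B d R, s x * u x).im := him.symm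
      _ ≤ _ := (le_abs_self _).trans h2
      _ ≤ _ := h3
      _ ≤ _ := mul_le_mul_of_nonneg_right h4 (norm_nonneg _)
  rcases (norm_nonneg u).eq_or_lt with h0 | h0
  · rw [← h0, mul_zero]
    positivity
  · rw [sq, ← mul_assoc] at h5
    exact le_of_mul_le_mul_right h5 h0

end Coercivity

/-! ### Hilbert space minimisation and the operators involved. -/

section Minimization

/-- Minimisation of a seminorm `‖T ·‖` over an affine subspace on whose direction it is coercive. -/
theorem exists_minimizer_of_coercive {E F : Type*} [NormedAddCommGroup E] [NormedSpace ℂ E]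
    [CompleteSpace E] [NormedAddCommGroup F] [InnerProductSpace ℂ F] (W : Submodule ℂ E)
    (hW : IsClosed (W : Set E)) (T : E →L[ℂ] F) (C : ℝ) (hC : ∀ w ∈ W, ‖w‖ ≤ C * ‖T w‖) (z : E) :
    ∃ w ∈ W, (∀ w' ∈ W, ‖T (z + w)‖ ≤ ‖T (z + w')‖)
      ∧ ∀ w' ∈ W, ‖T (z + w')‖ = ‖T (z + w)‖ → w' = w := by
  have : CompleteSpace W := hW.completeSpace_coe
  let T' : W →L[ℂ] F := T.comp W.subtypeL
  -- Coercivity makes the image of `W` complete, so the orthogonal projection onto it exists.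
  have hanti : AntilipschitzWith (Real.toNNReal C) T' := by
    refine AddMonoidHomClass.antilipschitz_of_bound T' fun w => ?_
    refine (hC w w.2).trans (mul_le_mul_of_nonneg_right (Real.le_coe_toNNReal C) (norm_nonneg _))
  set K : Submodule ℂ F := LinearMap.range T'.toLinearMap with hK
  have hKc : IsComplete (K : Set F) := by
    rw [hK, LinearMap.coe_range]
    exact hanti.isComplete_range T'.uniformContinuous
  have : CompleteSpace K := hKc.completeSpace_coe
  obtain ⟨w1, hw1⟩ := K.starProjection_apply_mem (T z)
  have hw1' : T w1 = K.starProjection (T z) := hw1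
  -- With `T w1` the projection of `T z`, Pythagoras isolates the dependence on `w'` in `‖T (w1 +
  -- w')‖²`. By coercivity this vanishes only at `w' = -w1`.
  have hpyth : ∀ w' ∈ W, ‖T (z + w')‖ ^ 2
      = ‖T z - K.starProjection (T z)‖ ^ 2 + ‖T (w1 + w')‖ ^ 2 := by
    intro w' hw'
    have h1 : inner ℂ (T z - K.starProjection (T z)) (T (w1 + w')) = 0 :=
      Submodule.inner_left_of_mem_orthogonal
        (LinearMap.mem_range_self T'.toLinearMap (w1 + ⟨w', hw'⟩))
        (K.sub_starProjection_mem_orthogonal (T z))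
    have h2 : T (z + w') = (T z - K.starProjection (T z)) + T (w1 + w') := by
      rw [map_add, map_add, hw1']
      abel
    rw [h2, sq, sq, sq]
    exact norm_add_sq_eq_norm_sq_add_norm_sq_of_inner_eq_zero _ _ h1
  have hmin : ‖T (z + -(w1 : E))‖ ^ 2 = ‖T z - K.starProjection (T z)‖ ^ 2 := by
    rw [hpyth _ (W.neg_mem w1.2)]
    simp
  refine ⟨-w1, W.neg_mem w1.2, fun w' hw' => ?_, fun w' hw' he => ?_⟩
  · refine abs_le_of_sq_le_sq' ?_ (norm_nonneg _) |>.2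
    rw [hmin, hpyth w' hw']
    nlinarith [sq_nonneg ‖T (w1 + w')‖]
  · have h1 := hpyth w' hw'
    rw [he, hmin] at h1
    have h2 : ‖T (w1 + w')‖ = 0 := by
      have : ‖T (w1 + w')‖ ^ 2 = 0 := by linarith
      exact pow_eq_zero_iff two_ne_zero |>.1 this
    have h3 := hC _ (W.add_mem w1.2 hw')
    rw [h2, mul_zero] at h3
    exact (neg_eq_of_add_eq_zero_right (norm_le_zero_iff.1 h3)).symm

variable {d : ℕ} {R : ℝ}

theorem exists_clm_coord_mul {q : Space d → ℂ} (hq : MemLp q 2 (volume.restrict (B d R)))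
    (i : Fin d) : ∃ L : L2Vec (B d R) →L[ℂ] ℂ, ∀ G, L G = ∫ x in B d R, G x i * q x := by
  refine ⟨(pairing (hq.toLp q)).comp
    ((EuclideanSpace.proj i : CVec d →L[ℂ] ℂ).compLpL 2 (volume.restrict (B d R))), fun G => ?_⟩
  rw [ContinuousLinearMap.comp_apply, pairing_apply]
  refine integral_congr_ae ?_
  filter_upwards [hq.coeFn_toLp, (EuclideanSpace.proj i : CVec d →L[ℂ] ℂ).coeFn_compLpL G]
    with x h1 h2
  rw [h1, h2, mul_comm]
  rfl

theorem exists_clm_mul {q : Space d → ℂ} (hq : MemLp q 2 (volume.restrict (B d R))) :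
    ∃ L : L2 (B d R) →L[ℂ] ℂ, ∀ u, L u = ∫ x in B d R, u x * q x := by
  refine ⟨pairing (hq.toLp q), fun u => ?_⟩
  rw [pairing_apply]
  refine integral_congr_ae ?_
  filter_upwards [hq.coeFn_toLp] with x h1
  rw [h1, mul_comm]

theorem exists_clm_isWeakGradient (φ : Space d → ℂ) (hφ : IsTestFunction ⊤ (B d R) φ) (i : Fin d) :
    ∃ L : L2 (B d R) × L2Vec (B d R) →L[ℂ] ℂ, ∀ z, L z = 0 ↔
      ∫ x in B d R, z.1 x * partialDeriv i φ x = -∫ x in B d R, z.2 x i * φ x := by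
  obtain ⟨L1, h1⟩ := exists_clm_mul (((hφ.partialDeriv i).memLp volume).restrict (B d R))
  obtain ⟨L2, h2⟩ := exists_clm_coord_mul ((hφ.memLp volume).restrict (B d R)) i
  refine ⟨L1.comp (ContinuousLinearMap.fst ℂ _ _) + L2.comp (ContinuousLinearMap.snd ℂ _ _),
    fun z => ?_⟩
  simp only [add_apply, ContinuousLinearMap.comp_apply,
    ContinuousLinearMap.coe_fst', ContinuousLinearMap.coe_snd', h1, h2]
  exact add_eq_zero_iff_eq_neg

/-- The functional is chosen before `f`, so the same one describes the homogeneous and inhomogeneous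
equations, and differences of solutions lie in its kernel. -/
theorem exists_clm_isWeakPair {V : Space d → ℂ} {M : ℝ} (hV : AEStronglyMeasurable V volume)
    (hM : ∀ᵐ x, ‖V x‖ ≤ M) (φ : Space d → ℂ) (hφ : IsTestFunction ⊤ (B d R) φ) :
    ∃ L : L2 (B d R) × L2Vec (B d R) →L[ℂ] ℂ, ∀ f : Space d → ℂ,
      MemLp f 2 (volume.restrict (B d R)) → ∀ z, L z = ∫ x in B d R, f x * φ x ↔
      (∫ x in B d R, (V x * z.1 x - f x) * φ x)
        + ∑ i, ∫ x in B d R, -z.2 x i * partialDeriv i φ x = 0 := by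
  have hVφ : MemLp (fun x => V x * φ x) 2 (volume.restrict (B d R)) :=
    (memLp_mul_of_ae_bound hV hM (hφ.memLp volume)).restrict _
  obtain ⟨L1, h1⟩ := exists_clm_mul hVφ
  choose P h2 using fun i => exists_clm_coord_mul
    (((hφ.partialDeriv i).memLp volume).restrict (B d R)) i
  refine ⟨L1.comp (ContinuousLinearMap.fst ℂ _ _)
    - ∑ i, (P i).comp (ContinuousLinearMap.snd ℂ _ _), fun f hf z => ?_⟩
  have hL : (L1.comp (ContinuousLinearMap.fst ℂ (L2 (B d R)) (L2Vec (B d R)))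
      - ∑ i, (P i).comp (ContinuousLinearMap.snd ℂ (L2 (B d R)) (L2Vec (B d R)))) z = L1 z.1 - ∑ i, P i z.2 := by
    simp [sum_apply]
  have e : ∫ x in B d R, (V x * z.1 x - f x) * φ x
      = (∫ x in B d R, z.1 x * (V x * φ x)) - ∫ x in B d R, f x * φ x := by
    rw [← integral_sub (integrable_mul_of_memLp (Lp.memLp z.1) hVφ)
      (integrable_mul_of_memLp hf ((hφ.memLp volume).restrict _))]
    refine integral_congr_ae (ae_of_all _ fun x => ?_)
    ring
  rw [hL, h1, e]
  simp only [h2, neg_mul, integral_neg, Finset.sum_neg_distrib]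
  constructor <;> intro h <;> linear_combination h

/-- The closed space of homogeneous weak solutions with their weak gradients. -/
theorem exists_submodule_homogeneous {V : Space d → ℂ} {M : ℝ}
    (hV : AEStronglyMeasurable V volume) (hM : ∀ᵐ x, ‖V x‖ ≤ M) :
    ∃ W : Submodule ℂ (L2 (B d R) × L2Vec (B d R)), IsClosed (W : Set (L2 (B d R) × L2Vec (B d R)))
      ∧ (∀ z, z ∈ W ↔ IsWeakGradient (B d R) z.1 z.2 ∧ IsWeakPair V 0 R z.1 z.2)
      ∧ ∀ f : Space d → ℂ, MemLp f 2 (volume.restrict (B d R)) → ∀ z z',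
        IsWeakGradient (B d R) z.1 z.2 → IsWeakPair V f R z.1 z.2 →
        (z' - z ∈ W ↔ IsWeakGradient (B d R) z'.1 z'.2 ∧ IsWeakPair V f R z'.1 z'.2) := by
  choose D hD using exists_clm_isWeakGradient (d := d) (R := R)
  choose L hL using exists_clm_isWeakPair (d := d) (R := R) hV hM
  let W : Submodule ℂ (L2 (B d R) × L2Vec (B d R)) :=
    (⨅ φ, ⨅ hφ, ⨅ i, LinearMap.ker (D φ hφ i).toLinearMap)
      ⊓ ⨅ φ, ⨅ hφ, LinearMap.ker (L φ hφ).toLinearMap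
  have hmem : ∀ z, z ∈ W ↔ (∀ φ hφ i, D φ hφ i z = 0) ∧ ∀ φ hφ, L φ hφ z = 0 := by
    intro z
    simp [W, Submodule.mem_iInf]
  refine ⟨W, ?_, fun z => ?_, fun f hf z z' hg hz => ?_⟩
  · have : (W : Set (L2 (B d R) × L2Vec (B d R)))
        = (⋂ φ, ⋂ hφ, ⋂ i, {z | D φ hφ i z = 0}) ∩ ⋂ φ, ⋂ hφ, {z | L φ hφ z = 0} := by
      ext z
      simp [hmem]
    rw [this]
    refine IsClosed.inter ?_ ?_
    · exact isClosed_iInter fun φ => isClosed_iInter fun hφ => isClosed_iInter fun i =>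
        isClosed_eq (D φ hφ i).continuous continuous_const
    · exact isClosed_iInter fun φ => isClosed_iInter fun hφ =>
        isClosed_eq (L φ hφ).continuous continuous_const
  · rw [hmem]
    refine and_congr ⟨fun h φ hφ i => (hD φ hφ i z).1 (h φ hφ i),
      fun h φ hφ i => (hD φ hφ i z).2 (h φ hφ i)⟩ ?_
    refine forall_congr' fun φ => forall_congr' fun hφ => ?_
    have := hL φ hφ 0 MemLp.zero z
    simpa using this
  · rw [hmem]
    simp only [map_sub]
    refine and_congr ⟨fun h φ hφ i => (hD φ hφ i z').1 ?_,
      fun h φ hφ i => ?_⟩ ?_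
    · have h1 := h φ hφ i
      rw [(hD φ hφ i z).2 (hg φ hφ i), sub_zero] at h1
      exact h1
    · rw [(hD φ hφ i z).2 (hg φ hφ i), sub_zero]
      exact (hD φ hφ i z').2 (h φ hφ i)
    · refine forall_congr' fun φ => forall_congr' fun hφ => ?_
      rw [(hL φ hφ f hf z).2 (hz φ hφ), sub_eq_zero]
      exact hL φ hφ f hf z'

/-- The operator `(u, G) ↦ (1 + |x|)^{-1/2} (G - i k n u x/|x|)`. -/
theorem exists_radiation_clm {k M : ℝ} {n : Space d → ℝ} (hk : 0 < k) (hM0 : 0 ≤ M)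
    (hn : AEStronglyMeasurable n volume) (hM : ∀ᵐ x, ‖n x‖ ≤ M) :
    ∃ T : L2 (B d R) × L2Vec (B d R) →L[ℂ] L2Vec (B d R), ∀ z,
      ∀ᵐ x ∂volume.restrict (B d R), T z x = (((Real.sqrt (1 + ‖x‖))⁻¹ : ℝ) : ℂ)
        • (z.2 x - (Complex.I * k * n x * z.1 x) • radialUnit x) := by
  let w : Space d → ℂ := fun x => (((Real.sqrt (1 + ‖x‖))⁻¹ : ℝ) : ℂ)
  have hwm : Continuous w := by
    refine Complex.continuous_ofReal.comp (Continuous.inv₀ (by fun_prop) fun x => ?_)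
    positivity
  have hw1 : ∀ x, ‖w x‖ ≤ 1 := fun x => by
    rw [Complex.norm_real, Real.norm_of_nonneg (by positivity)]
    refine inv_le_one_of_one_le₀ (Real.one_le_sqrt.2 ?_)
    linarith [norm_nonneg x]
  let A : Space d → CVec d := fun x => -(w x * (Complex.I * k * n x)) • radialUnit x
  have hAm : AEStronglyMeasurable A (volume.restrict (B d R)) :=
    (((hwm.aestronglyMeasurable.mul ((Complex.continuous_ofReal.comp_aestronglyMeasurable
      hn).const_mul _)).neg).restrict).smul measurable_radialUnit.aestronglyMeasurable
  have hA : ∀ᵐ x ∂volume.restrict (B d R), ‖A x‖ ≤ k * M := by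
    refine ae_restrict_of_ae ?_
    filter_upwards [hM] with x hx
    simp only [A, norm_smul, norm_neg, norm_mul, Complex.norm_I, one_mul, Complex.norm_real]
    rw [Real.norm_of_nonneg hk.le]
    calc _ ≤ 1 * (k * M) * 1 := by
          gcongr
          · exact hw1 x
          · exact norm_radialUnit_le x
      _ = k * M := by ring
  have hm1 : ∀ u : L2 (B d R), MemLp (fun x => u x • A x) 2 (volume.restrict (B d R)) := by
    intro u
    refine (Lp.memLp u).of_le_mul (c := k * M) ((Lp.aestronglyMeasurable u).smul hAm) ?_
    filter_upwards [hA] with x hx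
    rw [norm_smul, mul_comm]
    exact mul_le_mul_of_nonneg_right hx (norm_nonneg _)
  have hm2 : ∀ G : L2Vec (B d R), MemLp (fun x => w x • G x) 2 (volume.restrict (B d R)) := by
    intro G
    refine (Lp.memLp G).of_le_mul (c := 1)
      (hwm.aestronglyMeasurable.smul (Lp.aestronglyMeasurable G)) (ae_of_all _ fun x => ?_)
    rw [norm_smul]
    exact mul_le_mul_of_nonneg_right (hw1 x) (norm_nonneg _)
  let T1 : L2 (B d R) →L[ℂ] L2Vec (B d R) := LinearMap.mkContinuous
    { toFun := fun u => (hm1 u).toLp _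
      map_add' := fun u v => by
        rw [← MemLp.toLp_add]
        refine MemLp.toLp_congr _ _ ?_
        filter_upwards [Lp.coeFn_add u v] with x hx
        rw [hx, Pi.add_apply, add_smul, Pi.add_apply]
      map_smul' := fun c u => by
        rw [RingHom.id_apply, ← MemLp.toLp_const_smul]
        refine MemLp.toLp_congr _ _ ?_
        filter_upwards [Lp.coeFn_smul c u] with x hx
        rw [hx, Pi.smul_apply, Pi.smul_apply, smul_assoc] } (k * M) fun u => by
      refine Lp.norm_le_mul_norm_of_ae_le_mul ?_
      filter_upwards [(hm1 u).coeFn_toLp, hA] with x h1 hx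
      refine (congrArg norm h1).trans_le ?_
      rw [norm_smul, mul_comm]
      exact mul_le_mul_of_nonneg_right hx (norm_nonneg _)
  let T2 : L2Vec (B d R) →L[ℂ] L2Vec (B d R) := LinearMap.mkContinuous
    { toFun := fun G => (hm2 G).toLp _
      map_add' := fun u v => by
        rw [← MemLp.toLp_add]
        refine MemLp.toLp_congr _ _ ?_
        filter_upwards [Lp.coeFn_add u v] with x hx
        rw [hx, Pi.add_apply, smul_add, Pi.add_apply]
      map_smul' := fun c u => by
        rw [RingHom.id_apply, ← MemLp.toLp_const_smul]
        refine MemLp.toLp_congr _ _ ?_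
        filter_upwards [Lp.coeFn_smul c u] with x hx
        rw [hx, Pi.smul_apply, Pi.smul_apply, smul_comm] } 1 fun u => by
      refine Lp.norm_le_mul_norm_of_ae_le_mul ?_
      filter_upwards [(hm2 u).coeFn_toLp] with x h1
      refine (congrArg norm h1).trans_le ?_
      rw [norm_smul]
      exact mul_le_mul_of_nonneg_right (hw1 x) (norm_nonneg _)
  refine ⟨T1.comp (ContinuousLinearMap.fst ℂ _ _) + T2.comp (ContinuousLinearMap.snd ℂ _ _),
    fun z => ?_⟩
  filter_upwards [(hm1 z.1).coeFn_toLp, (hm2 z.2).coeFn_toLp,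
    Lp.coeFn_add ((hm1 z.1).toLp _) ((hm2 z.2).toLp _)] with x h1 h2 h3
  refine h3.trans ?_
  rw [Pi.add_apply, h1, h2]
  simp only [A]
  change _ = w x • _
  rw [smul_sub, smul_smul, smul_smul, sub_eq_add_neg, ← neg_smul, add_comm]
  congr 2
  ring

end Minimization

/-! ### Lower bound for the radiation operator on homogeneous solutions. -/

section Main

variable {d : ℕ} {R : ℝ}

theorem radiationSeminorm_eq_norm {k : ℝ} {n : Space d → ℝ} {u : H1 (B d R)} {v : L2Vec (B d R)}
    (h : ∀ᵐ x ∂volume.restrict (B d R), v x = (((Real.sqrt (1 + ‖x‖))⁻¹ : ℝ) : ℂ)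
        • (weakGradient u x - (Complex.I * k * n x * u.1 x) • radialUnit x)) :
    radiationSeminorm k n R u = ‖v‖ := by
  rw [radiationSeminorm, ← Real.sqrt_sq (norm_nonneg v), ← integral_norm_sq_eq]
  congr 1
  refine integral_congr_ae ?_
  filter_upwards [h] with x hx
  have h1 : (0 : ℝ) ≤ 1 + ‖x‖ := by positivity
  rw [hx, norm_smul, Complex.norm_real, norm_inv, Real.norm_of_nonneg (Real.sqrt_nonneg _), mul_pow,
    inv_pow, Real.sq_sqrt h1, div_eq_inv_mul]

theorem norm_le_of_inv_sqrt_smul {v : L2Vec (B d R)} {g : Space d → CVec d}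
    (h : ∀ᵐ x ∂volume.restrict (B d R), v x = (((Real.sqrt (1 + ‖x‖))⁻¹ : ℝ) : ℂ) • g x) :
    ∀ᵐ x ∂volume.restrict (B d R), ‖g x‖ ≤ Real.sqrt (1 + R) * ‖v x‖ := by
  filter_upwards [h, ae_restrict_mem measurableSet_ball] with x hx hxB
  have h1 : (0 : ℝ) < Real.sqrt (1 + ‖x‖) := by positivity
  rw [hx, norm_smul, Complex.norm_real, norm_inv, Real.norm_of_nonneg h1.le, ← mul_assoc,
    ← div_eq_mul_inv]
  refine le_mul_of_one_le_left (norm_nonneg _) ((one_le_div h1).2 (Real.sqrt_le_sqrt ?_))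
  linarith [mem_ball_zero_iff.1 hxB]

/-- The radiation operator is bounded below on homogeneous solutions. -/
theorem exists_norm_le_radiation (hd : 1 ≤ d) {k M nstar : ℝ} {n : Space d → ℝ} (hR : 0 < R)
    (hk : 0 < k) (hn : AEStronglyMeasurable n volume) (hM : ∀ᵐ x, ‖n x‖ ≤ M)
    (hs : 0 < nstar) (hnstar : ∀ x, nstar ≤ n x)
    (T : L2 (B d R) × L2Vec (B d R) →L[ℂ] L2Vec (B d R))
    (hT : ∀ z, ∀ᵐ x ∂volume.restrict (B d R), T z x = (((Real.sqrt (1 + ‖x‖))⁻¹ : ℝ) : ℂ)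
        • (z.2 x - (Complex.I * k * n x * z.1 x) • radialUnit x)) :
    ∃ C, ∀ z, IsWeakGradient (B d R) z.1 z.2 →
      IsWeakPair (fun x => (k : ℂ) ^ 2 * (n x : ℂ) ^ 2) 0 R z.1 z.2 → ‖z‖ ≤ C * ‖T z‖ := by
  set c := Real.sqrt (1 + R) with hc
  have hc0 : 0 ≤ c := Real.sqrt_nonneg _
  set c1 := c / (k * nstar) with hc1
  have hc1' : 0 ≤ c1 := by positivity
  -- The first summand bounds `u`, the second `G`; their sum dominates the sup norm of the pair.
  refine ⟨c1 + c * (1 + ‖T‖ * c1), fun z hz1 hz2 => ?_⟩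
  have hu : ‖z.1‖ ≤ c1 * ‖T z‖ := by
    have := mul_norm_le_of_radiation hd hR hk hn hM hc0 hnstar hz1 hz2 (T z)
      (norm_le_of_inv_sqrt_smul (hT z))
    rw [hc1, div_mul_eq_mul_div, le_div_iff₀ (by positivity)]
    linarith
  -- `T (0, G)` is just `G` with the weight, and it differs from `T z` by `T (u, 0)`, which the
  -- bound on `u` already controls.
  have hG : ‖z.2‖ ≤ c * ‖T (0, z.2)‖ := by
    refine Lp.norm_le_mul_norm_of_ae_le_mul ?_
    refine norm_le_of_inv_sqrt_smul (v := T (0, z.2)) ?_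
    filter_upwards [hT (0, z.2), Lp.coeFn_zero ℂ 2 (volume.restrict (B d R))] with x h1 h2
    rw [h1, h2]
    simp
  have hsplit : T (0, z.2) = T z - T (z.1, 0) := by
    rw [← map_sub]
    congr 1
    ext1 <;> simp
  have h1 : ‖T (z.1, 0)‖ ≤ ‖T‖ * ‖z.1‖ := by
    refine (T.le_opNorm _).trans_eq ?_
    rw [Prod.norm_mk, norm_zero, max_eq_left (norm_nonneg _)]
  have h2 : ‖z.2‖ ≤ c * (1 + ‖T‖ * c1) * ‖T z‖ := by
    refine hG.trans ?_
    rw [mul_assoc]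
    refine mul_le_mul_of_nonneg_left ?_ hc0
    rw [hsplit]
    calc ‖T z - T (z.1, 0)‖ ≤ ‖T z‖ + ‖T (z.1, 0)‖ := norm_sub_le _ _
      _ ≤ ‖T z‖ + ‖T‖ * (c1 * ‖T z‖) := by
        gcongr
        exact h1.trans (by gcongr)
      _ = _ := by ring
  have h3 : 0 ≤ c1 * ‖T z‖ := by positivity
  have h4 : 0 ≤ c * (1 + ‖T‖ * c1) * ‖T z‖ := by positivity
  rw [Prod.norm_def, add_mul]
  exact max_le (by linarith) (by linarith)

end Main

end Helmholtz

end

theorem mainTheorem2 (d : ℕ) (hd : 2 ≤ d) (k : ℝ) (hk : 0 < k) (R : ℝ) (hR : 0 < R)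
    (n : Helmholtz.Space d → ℝ)
    (hn_bdd : MemLp n ⊤ volume)
    (hn_pos : ∃ nstar : ℝ, 0 < nstar ∧ ∀ x, nstar ≤ n x)
    (hn_mean : eLpNorm (fun x => 1 - Helmholtz.sphereMean n ‖x‖ / n x) ⊤ volume < 1)
    (f : Helmholtz.Space d → ℂ)
    (hf : MemLp f 2 (volume.restrict (Helmholtz.B d R))) :
    ∃! u : Helmholtz.H1 (Helmholtz.B d R),
      u ∈ Helmholtz.solutionSet k n f R ∧
        Helmholtz.radiationSeminorm k n R u = Helmholtz.minValue k n f R := by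
  open Helmholtz in
  obtain ⟨nstar, hs, hnstar⟩ := hn_pos
  have hn := hn_bdd.1
  obtain ⟨M, hM0, hM⟩ : ∃ M : ℝ, 0 ≤ M ∧ ∀ᵐ x, ‖n x‖ ≤ M := by
    refine ⟨(eLpNorm n ⊤ volume).toReal, ENNReal.toReal_nonneg, ?_⟩
    rw [eLpNorm_exponent_top]
    filter_upwards [ae_le_eLpNormEssSup (f := n) (μ := volume)] with x hx
    rw [← toReal_enorm]
    refine ENNReal.toReal_mono ?_ hx
    rw [← eLpNorm_exponent_top]
    exact hn_bdd.2.ne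
  have hVm : AEStronglyMeasurable (fun x => (k : ℂ) ^ 2 * (n x : ℂ) ^ 2) volume :=
    ((Complex.continuous_ofReal.comp_aestronglyMeasurable hn).pow 2).const_mul _
  have hVM : ∀ᵐ x, ‖(k : ℂ) ^ 2 * (n x : ℂ) ^ 2‖ ≤ k ^ 2 * M ^ 2 := by
    filter_upwards [hM] with x hx
    rw [norm_mul, norm_pow, norm_pow, Complex.norm_real, Complex.norm_real,
      Real.norm_of_nonneg hk.le]
    gcongr
  obtain ⟨u0, G0, hG0, hu0⟩ := exists_isWeakPair hR (⟨0, by omega⟩ : Fin d) (by positivity) hVm hVM hf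
  obtain ⟨W, hWc, hW0, hWf⟩ := exists_submodule_homogeneous (d := d) (R := R) hVm hVM
  obtain ⟨T, hT⟩ := exists_radiation_clm (R := R) hk hM0 hn hM
  obtain ⟨C, hC⟩ := exists_norm_le_radiation (by omega) hR hk hn hM hs hnstar T hT
  obtain ⟨w, hw, hmin, huniq⟩ := exists_minimizer_of_coercive W hWc T C
    (fun z hz => hC z ((hW0 z).1 hz).1 ((hW0 z).1 hz).2) (u0, G0)
  have hsol : ∀ u : H1 (B d R), u ∈ solutionSet k n f R ↔
      ((u.1, weakGradient u) - (u0, G0) : L2 (B d R) × L2Vec (B d R)) ∈ W := by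
    intro u
    rw [hWf f hf (u0, G0) (u.1, weakGradient u) hG0 hu0]
    exact (isWeakSolution_iff hR hn hM hf u).trans
      ⟨fun h => ⟨weakGradient_spec u, h⟩, fun h => h.2⟩
  have hsem : ∀ u : H1 (B d R), radiationSeminorm k n R u
      = ‖T ((u0, G0) + ((u.1, weakGradient u) - (u0, G0)))‖ := fun u => by
    rw [add_sub_cancel]
    exact radiationSeminorm_eq_norm (hT (u.1, weakGradient u))
  set z : L2 (B d R) × L2Vec (B d R) := (u0, G0) + w with hz
  have hzw : z - (u0, G0) = w := by rw [hz, add_sub_cancel_left]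
  obtain ⟨hzG, -⟩ := (hWf f hf (u0, G0) z hG0 hu0).1 (by rw [hzw]; exact hw)
  -- Closedness of `W` keeps the minimising pair among genuine solution pairs, so its second
  -- component is the weak gradient of its first.
  let v : H1 (B d R) := ⟨z.1, z.2, hzG⟩
  have hv : (v.1, weakGradient v) = z := by
    rw [weakGradient_eq hzG]
  have hvsol : v ∈ solutionSet k n f R := by
    rw [hsol, hv, hzw]
    exact hw
  have hvmin : radiationSeminorm k n R v = minValue k n f R := by
    refine (IsLeast.csInf_eq ⟨Set.mem_image_of_mem _ hvsol, ?_⟩).symm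
    rintro _ ⟨u, hu, rfl⟩
    rw [hsem, hsem, hv, hzw]
    exact hmin _ ((hsol u).1 hu)
  refine ⟨v, ⟨hvsol, hvmin⟩, fun u hu => ?_⟩
  have h1 := huniq _ ((hsol u).1 hu.1) (by
    rw [← hsem, hu.2, ← hvmin, hsem, hv, hzw])
  rw [← hzw, sub_left_inj] at h1
  exact Subtype.ext (congrArg Prod.fst h1)
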